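/- Let $n\ge 2$ and let $M=\{x\in\mathbb{R}^n : |x|\in I\}$ be an open symmetric domain, where $I$ is one of $[0,\nu)$, $(\nu_2,\nu_1)$, $[0,\infty)$, $(\nu_2,\infty)$ with $\nu>0$ and $0\le\nu_2<\nu_1$ (ball, spherical shell or punctured ball, the whole space, exterior domain). Let $g,h$ be real functions on $I$ that are smooth as radial functions, i.e. $x\mapsto g(|x|)$ and $x\mapsto h(|x|)$ are $C^\infty$ on $M$, and let $\epsilon>0$. Suppose that $1-2r^2g(r)\neq 0$ on $I$ and that $$T(r)=\frac{e^{-\int\frac{4rg(r)}{1-2r^2g(r)}\,dr}}{(1-2r^2g(r))^2},\qquad \overline{T}(r)=4\int\frac{g'(r)+2rg^2(r)}{1-2r^2g(r)}\,T(r)\,dr$$ on $I$, for some choice of the antiderivatives, and that $T(r)-r^2\overline{T}(r)>0$ on $I$. Put $D(r,s)=T(r)-\overline{T}(r)(r^2-s^2)$ (then $D>0$ for $r\in I$, $|s|\le r$) and $$\phi(r,s)=s\,h(r)+\frac{\left[(T-r^2\overline{T})(r^2-s^2)\right]^2+4r^2s^2\,T\,D-\frac43 s^4T^2}{(T-r^2\overline{T})^3\,D^{3/2}}+\epsilon\,\frac{\sqrt{D}}{T-r^2\overline{T}},$$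 where $T=T(r)$, $\overline{T}=\overline{T}(r)$, $D=D(r,s)$, and assume that $\phi(r,s)>0$ for all $r\in I$, $|s|\le r$. Then: 1. $\phi$ is the function produced by $\eta(x)=\sqrt{-x}\,\left((-x)^m+\epsilon\right)$ with $m=2$ and $\varphi(r,s)=\dfrac{r^2-s^2}{(r^2-s^2)\overline{T}(r)-T(r)}$, that is, $\phi=s\left(h(r)-\int\frac{\eta(\varphi(r,s))}{s^2\sqrt{r^2-s^2}}\,ds\right)$, in the sense that $$\frac{\partial}{\partial s}\left(\frac{\phi(r,s)}{s}\right)=-\frac{\eta(\varphi(r,s))}{s^2\sqrt{r^2-s^2}}\qquad (r\in I,\ 0<|s|<r).$$ 2. $F(x,y)=|y|\,\phi\left(|x|,\frac{\langle x,y\rangle}{|y|}\right)$ (with $F(x,0)=0$) is a Finsler metric on $M$, and it is a Douglas metric, i.e. its Douglas curvature vanishes on $M$. 3. $F$ is of scalar flag curvature: its flag curvature $K(P,y)$ at $x\in M$ depends only on $(x,y)$ and not on the plane $P\ni y$. -/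

import Mathlib

open scoped ContDiff

noncomputable section

namespace SphFinsler

/-! ### Finsler metrics on an open subset of Euclidean space, in the standard coordinates -/

/-- The `i`-th partial derivative of `f` at `v`. -/
def pd {n : ℕ} (i : Fin n) (f : EuclideanSpace ℝ (Fin n) → ℝ)
    (v : EuclideanSpace ℝ (Fin n)) : ℝ :=
  fderiv ℝ f v (EuclideanSpace.single i 1)

/-- The fundamental tensor `g_ij(x, y) = (1/2) ∂²F²/∂yⁱ∂yʲ`. -/
def fundTensor {n : ℕ} (F : EuclideanSpace ℝ (Fin n) → EuclideanSpace ℝ (Fin n) → ℝ)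
    (x y : EuclideanSpace ℝ (Fin n)) : Matrix (Fin n) (Fin n) ℝ :=
  Matrix.of fun i j => (1 / 2) * pd i (pd j (fun z => F x z ^ 2)) y

/-- The inner product `g_y(u, v)` on the tangent space at `x`. -/
def gInner {n : ℕ} (F : EuclideanSpace ℝ (Fin n) → EuclideanSpace ℝ (Fin n) → ℝ)
    (x y u v : EuclideanSpace ℝ (Fin n)) : ℝ :=
  ∑ i, ∑ j, fundTensor F x y i j * u i * v j

/-- `F` is a Finsler metric on `M` (used for `M` open): it is nonnegative, smooth on the slit
tangent bundle, and each `F x` is a Minkowski norm (positively homogeneous, with positive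
definite fundamental tensor off the origin). -/
structure IsFinslerMetric {n : ℕ} (M : Set (EuclideanSpace ℝ (Fin n)))
    (F : EuclideanSpace ℝ (Fin n) → EuclideanSpace ℝ (Fin n) → ℝ) : Prop where
  nonneg : ∀ x ∈ M, ∀ y, 0 ≤ F x y
  smooth : ContDiffOn ℝ ∞
    (fun p : EuclideanSpace ℝ (Fin n) × EuclideanSpace ℝ (Fin n) => F p.1 p.2)
    (M ×ˢ {y | y ≠ 0})
  homogeneous : ∀ x ∈ M, ∀ y, ∀ c : ℝ, 0 < c → F x (c • y) = c * F x y
  posDef : ∀ x ∈ M, ∀ y, y ≠ 0 → ∀ u, u ≠ 0 → 0 < gInner F x y u u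

/-- The geodesic (spray) coefficients
`Gⁱ = (1/4) gⁱˡ ( yᵏ ∂²F²/∂xᵏ∂yˡ - ∂F²/∂xˡ )`. -/
def spray {n : ℕ} (F : EuclideanSpace ℝ (Fin n) → EuclideanSpace ℝ (Fin n) → ℝ)
    (i : Fin n) (x y : EuclideanSpace ℝ (Fin n)) : ℝ :=
  (1 / 4) * ∑ l, (fundTensor F x y)⁻¹ i l *
    ((∑ k, y k * pd k (fun x' => pd l (fun y' => F x' y' ^ 2) y) x)
      - pd l (fun x' => F x' y ^ 2) x)

/-- The Douglas curvature
`D_jⁱ_kl = ∂³/∂yʲ∂yᵏ∂yˡ ( Gⁱ - (1/(n+1)) (∑ₘ ∂Gᵐ/∂yᵐ) yⁱ )`. -/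
def douglas {n : ℕ} (F : EuclideanSpace ℝ (Fin n) → EuclideanSpace ℝ (Fin n) → ℝ)
    (j i k l : Fin n) (x y : EuclideanSpace ℝ (Fin n)) : ℝ :=
  pd j (pd k (pd l (fun z =>
    spray F i x z - 1 / ((n : ℝ) + 1) * (∑ m, pd m (spray F m x) z) * z i))) y

/-- `F` has vanishing Douglas curvature on `M`. -/
def HasZeroDouglasCurvature {n : ℕ} (M : Set (EuclideanSpace ℝ (Fin n)))
    (F : EuclideanSpace ℝ (Fin n) → EuclideanSpace ℝ (Fin n) → ℝ) : Prop :=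
  ∀ x ∈ M, ∀ y, y ≠ 0 → ∀ j i k l : Fin n, douglas F j i k l x y = 0

/-- A Douglas metric on `M`: a Finsler metric with vanishing Douglas curvature. -/
def IsDouglasMetric {n : ℕ} (M : Set (EuclideanSpace ℝ (Fin n)))
    (F : EuclideanSpace ℝ (Fin n) → EuclideanSpace ℝ (Fin n) → ℝ) : Prop :=
  IsFinslerMetric M F ∧ HasZeroDouglasCurvature M F

/-- The Riemann curvature
`Rⁱ_k = 2 ∂Gⁱ/∂xᵏ - yʲ ∂²Gⁱ/∂xʲ∂yᵏ + 2 Gʲ ∂²Gⁱ/∂yʲ∂yᵏ - (∂Gⁱ/∂yʲ)(∂Gʲ/∂yᵏ)`. -/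
def riemann {n : ℕ} (F : EuclideanSpace ℝ (Fin n) → EuclideanSpace ℝ (Fin n) → ℝ)
    (x y : EuclideanSpace ℝ (Fin n)) : Matrix (Fin n) (Fin n) ℝ :=
  Matrix.of fun i k =>
    2 * pd k (fun x' => spray F i x' y) x
      - (∑ j, y j * pd j (fun x' => pd k (spray F i x') y) x)
      + 2 * (∑ j, spray F j x y * pd j (pd k (spray F i x)) y)
      - ∑ j, pd j (spray F i x) y * pd k (spray F j x) y

/-- The flag curvature `K(P, y)` of the flag `P = span {y, u}` with pole `y`. -/
def flagCurvature {n : ℕ} (F : EuclideanSpace ℝ (Fin n) → EuclideanSpace ℝ (Fin n) → ℝ)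
    (x y u : EuclideanSpace ℝ (Fin n)) : ℝ :=
  gInner F x y (WithLp.toLp 2 ((riemann F x y).mulVec u)) u /
    (gInner F x y y y * gInner F x y u u - gInner F x y y u ^ 2)

/-- `F` is of scalar flag curvature on `M`: `K(P, y)` depends on `(x, y)` only. -/
def IsOfScalarFlagCurvature {n : ℕ} (M : Set (EuclideanSpace ℝ (Fin n)))
    (F : EuclideanSpace ℝ (Fin n) → EuclideanSpace ℝ (Fin n) → ℝ) : Prop :=
  ∃ K : EuclideanSpace ℝ (Fin n) → EuclideanSpace ℝ (Fin n) → ℝ,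
    ∀ x ∈ M, ∀ y u, LinearIndependent ℝ ![y, u] → flagCurvature F x y u = K x y

/-! ### Spherically symmetric domains and metrics -/

/-- The sets of radii of the symmetric domains: balls about the origin, spherical shells
(including punctured balls), the whole space, and complements of closed balls
(including the punctured space). -/
def IsRadiusInterval (I : Set ℝ) : Prop :=
  (∃ ν : ℝ, 0 < ν ∧ I = Set.Ico 0 ν) ∨
  (∃ ν₂ ν₁ : ℝ, 0 ≤ ν₂ ∧ ν₂ < ν₁ ∧ I = Set.Ioo ν₂ ν₁) ∨
  I = Set.Ici 0 ∨
  (∃ ν₂ : ℝ, 0 ≤ ν₂ ∧ I = Set.Ioi ν₂)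

/-- The symmetric domain `{x ∈ ℝⁿ : |x| ∈ I}`. -/
def symDomain (n : ℕ) (I : Set ℝ) : Set (EuclideanSpace ℝ (Fin n)) := {x | ‖x‖ ∈ I}

/-- `F(x, y) = |y| φ(|x|, ⟨x, y⟩ / |y|)`. -/
def sphMetric (n : ℕ) (φ : ℝ → ℝ → ℝ) (x y : EuclideanSpace ℝ (Fin n)) : ℝ :=
  ‖y‖ * φ ‖x‖ (inner ℝ x y / ‖y‖)

/-- `B` is an antiderivative of `b` on `I` (one-sided at an endpoint that belongs to `I`). -/
def IsAntiderivOn (I : Set ℝ) (b B : ℝ → ℝ) : Prop :=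
  ∀ r ∈ I, HasDerivWithinAt B (b r) I r

/-- `T = exp(-∫ 4 r g / (1 - 2 r² g) dr) / (1 - 2 r² g)²`, where `J` is the chosen antiderivative
of `4 r g / (1 - 2 r² g)`. -/
def Tfun (g J : ℝ → ℝ) (r : ℝ) : ℝ := Real.exp (-J r) / (1 - 2 * r ^ 2 * g r) ^ 2

/-- The functions `T` and `Tbar` are well defined on `I` by
`T = exp(-∫ 4 r g / (1 - 2 r² g) dr) / (1 - 2 r² g)²` and
`Tbar = 4 ∫ (g' + 2 r g²) / (1 - 2 r² g) T dr`, for some choice of the antiderivatives. -/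
def IsTPair (I : Set ℝ) (g T Tbar : ℝ → ℝ) : Prop :=
  (∀ r ∈ I, 1 - 2 * r ^ 2 * g r ≠ 0) ∧
  (∃ J : ℝ → ℝ, IsAntiderivOn I (fun r => 4 * r * g r / (1 - 2 * r ^ 2 * g r)) J ∧
    ∀ r ∈ I, T r = Tfun g J r) ∧
  IsAntiderivOn I
    (fun r => 4 * ((derivWithin g I r + 2 * r * g r ^ 2) / (1 - 2 * r ^ 2 * g r) * T r)) Tbar

/-- `φ(r, s) = (r² - s²) / ((r² - s²) Tbar(r) - T(r))`. -/
def varphi (T Tbar : ℝ → ℝ) (r s : ℝ) : ℝ :=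
  (r ^ 2 - s ^ 2) / ((r ^ 2 - s ^ 2) * Tbar r - T r)

/-- `η(x) = √(-x) ((-x)ᵐ + ε)`. -/
def eta (m : ℕ) (ε x : ℝ) : ℝ := √(-x) * ((-x) ^ m + ε)

/-- The explicit function `φ` for `m = 2`; here `D ^ (3/2)` is written `D * √D` with
`D = T - Tbar (r² - s²)`. -/
def phiTwo (T Tbar h : ℝ → ℝ) (ε r s : ℝ) : ℝ :=
  s * h r
    + (((T r - r ^ 2 * Tbar r) * (r ^ 2 - s ^ 2)) ^ 2
        + 4 * r ^ 2 * s ^ 2 * T r * (T r - Tbar r * (r ^ 2 - s ^ 2))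
        - 4 / 3 * s ^ 4 * T r ^ 2)
      / ((T r - r ^ 2 * Tbar r) ^ 3 *
          ((T r - Tbar r * (r ^ 2 - s ^ 2)) * √(T r - Tbar r * (r ^ 2 - s ^ 2))))
    + ε * (√(T r - Tbar r * (r ^ 2 - s ^ 2)) / (T r - r ^ 2 * Tbar r))

end SphFinsler

end

/-! ### Coordinate partial derivatives and the fundamental tensor through Fréchet derivatives in (x,
y) -/

noncomputable section
namespace SphFinsler

open Filter Topology

section Calculus

variable {n : ℕ}

/-! Write R = |x|², N = |y|², S = ⟨x, y⟩, B = Tbar, A = T − RB, W = RN − S² and a² = AN + BS². Off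
the zero section F is a rational function of T, B, h, R, S, a (`profile`), homogeneous of degree 1
in (S, a), and its fibre gradient is U y + V x with U = (ε + (W/a²)²)/a.

The key is a comparison spray with coefficients q x, where q = gN + fS² and f is built from g in
`quadCoeff`. The integral formulas for T and Tbar say that ∇T = 4T(g + Rf) x and ∇B = 4Tf x. With
these, a and W, hence U, have zero derivative in the direction (y, −2qx). The Euler-Lagrange
equation of F in that direction then reduces to one scalar identity, for the coefficient of x
(`profileV_along_spray`). By Rapcsák's criterion the spray of F is G = q x + P y (`spray_eq`).

Douglas: the fibre divergence of G is dq(x) + (n+1)P, so P drops out of the Douglas tensor. What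
remains is quadratic in y and is killed by three fibre derivatives.

Scalar curvature: the Riemann operator of q x + P y sends u to a combination of u, y and x. Its
x-component is `weylDefect`, which vanishes because the definition of f amounts to ∇g = (f(1 − 2Rg)
− 2g²) x (`weylDefect_quadFactor`). Thus u goes to κu + τy. Since F_y annihilates the image
(`fderiv_riemannOp`), τ is determined and K = κ/F².

Convexity: the fibre Hessian is explicit (`profile_hessian`), and a Gram inequality reduces its
positivity to a² + BW = TN > 0. The formula for η is the case N = 1 of F = NU + SV, together with
∂φ/∂s = V. -/

theorem sum_smul_single (v : EuclideanSpace ℝ (Fin n)) :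
    ∑ j, v j • EuclideanSpace.single j (1 : ℝ) = v := by
  ext i
  simp [Finset.sum_apply, Pi.single_apply]

theorem sum_apply_fst {W : Type*} [NormedAddCommGroup W] [NormedSpace ℝ W]
    (L : EuclideanSpace ℝ (Fin n) × EuclideanSpace ℝ (Fin n) →L[ℝ] W)
    (v : EuclideanSpace ℝ (Fin n)) :
    ∑ j, v j • L (EuclideanSpace.single j 1, 0) = L (v, 0) := by
  have h : L (v, 0) = (L.comp (ContinuousLinearMap.inl ℝ _ _)) v := by simp
  rw [h]
  conv_rhs => rw [← sum_smul_single v]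
  simp [map_sum]

theorem sum_apply_snd {W : Type*} [NormedAddCommGroup W] [NormedSpace ℝ W]
    (L : EuclideanSpace ℝ (Fin n) × EuclideanSpace ℝ (Fin n) →L[ℝ] W)
    (v : EuclideanSpace ℝ (Fin n)) :
    ∑ j, v j • L (0, EuclideanSpace.single j 1) = L (0, v) := by
  have h : L (0, v) = (L.comp (ContinuousLinearMap.inr ℝ _ _)) v := by simp
  rw [h]
  conv_rhs => rw [← sum_smul_single v]
  simp [map_sum]

theorem pd_congr {i : Fin n} {f g : EuclideanSpace ℝ (Fin n) → ℝ} {v : EuclideanSpace ℝ (Fin n)}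
    (h : f =ᶠ[𝓝 v] g) : pd i f v = pd i g v := by
  simp only [pd, h.fderiv_eq]

theorem pd_snd {f : EuclideanSpace ℝ (Fin n) × EuclideanSpace ℝ (Fin n) → ℝ}
    {x y : EuclideanSpace ℝ (Fin n)} (i : Fin n) (h : DifferentiableAt ℝ f (x, y)) :
    pd i (fun z => f (x, z)) y = fderiv ℝ f (x, y) (0, EuclideanSpace.single i 1) := by
  have h1 : HasFDerivAt (fun z => f (x, z))
      ((fderiv ℝ f (x, y)).comp (ContinuousLinearMap.inr ℝ _ _)) y :=
    h.hasFDerivAt.comp y (hasFDerivAt_prodMk_right x y)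
  simp [pd, h1.fderiv]

theorem pd_fst {f : EuclideanSpace ℝ (Fin n) × EuclideanSpace ℝ (Fin n) → ℝ}
    {x y : EuclideanSpace ℝ (Fin n)} (i : Fin n) (h : DifferentiableAt ℝ f (x, y)) :
    pd i (fun z => f (z, y)) x = fderiv ℝ f (x, y) (EuclideanSpace.single i 1, 0) := by
  have h1 : HasFDerivAt (fun z => f (z, y))
      ((fderiv ℝ f (x, y)).comp (ContinuousLinearMap.inl ℝ _ _)) x :=
    h.hasFDerivAt.comp (f := fun z => (z, y)) x (hasFDerivAt_prodMk_left x y)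
  simp [pd, h1.fderiv]

variable {V W : Type*} [NormedAddCommGroup V] [NormedSpace ℝ V]
  [NormedAddCommGroup W] [NormedSpace ℝ W]

/-- A second derivative is a derivative of the first derivative in a fixed direction. -/
theorem hasFDerivAt_fderiv_apply {f : V → W} {p : V} (h : ContDiffAt ℝ 2 f p) (w : V) :
    HasFDerivAt (fun p' => fderiv ℝ f p' w) ((fderiv ℝ (fderiv ℝ f) p).flip w) p := by
  have h1 : DifferentiableAt ℝ (fderiv ℝ f) p :=
    (h.fderiv_right (m := 1) (by norm_num)).differentiableAt (by norm_num)
  have := h1.hasFDerivAt.clm_apply (hasFDerivAt_const w p)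
  refine this.congr_fderiv ?_
  ext v
  simp

theorem fderiv_fderiv_symm {f : V → W} {p : V} (h : ContDiffAt ℝ 2 f p) (v w : V) :
    fderiv ℝ (fderiv ℝ f) p v w = fderiv ℝ (fderiv ℝ f) p w v :=
  (h.isSymmSndFDerivAt (by simp)).eq v w

theorem eventually_differentiableAt {f : V → W} {p : V} (h : ContDiffAt ℝ 2 f p) :
    ∀ᶠ p' in 𝓝 p, DifferentiableAt ℝ f p' :=
  (h.eventually (by simp)).mono fun _ hp => hp.differentiableAt (by norm_num)

/-- The derivative of `fderiv f` in the direction `v`, from a formula valid near `p`. -/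
theorem fderiv_fderiv_eq_of_eventuallyEq {f : V → W} {p w : V} {k : V → W}
    {k' : V →L[ℝ] W} (h : ContDiffAt ℝ 2 f p)
    (hk : (fun p' => fderiv ℝ f p' w) =ᶠ[𝓝 p] k) (hk' : HasFDerivAt k k' p) (v : V) :
    fderiv ℝ (fderiv ℝ f) p v w = k' v := by
  have h1 := (hasFDerivAt_fderiv_apply h w).congr_of_eventuallyEq hk.symm
  have := h1.unique hk'
  rw [← this]
  rfl

theorem pd_pd_snd {f : EuclideanSpace ℝ (Fin n) × EuclideanSpace ℝ (Fin n) → ℝ}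
    {x y : EuclideanSpace ℝ (Fin n)} (i j : Fin n) (h : ContDiffAt ℝ 2 f (x, y)) :
    pd i (fun z => pd j (fun z' => f (x, z')) z) y =
      fderiv ℝ (fderiv ℝ f) (x, y) (0, EuclideanSpace.single i 1)
        (0, EuclideanSpace.single j 1) := by
  have h1 : (fun z => pd j (fun z' => f (x, z')) z) =ᶠ[𝓝 y]
      fun z => fderiv ℝ f (x, z) (0, EuclideanSpace.single j 1) := by
    have hc : Tendsto (fun z => (x, z)) (𝓝 y) (𝓝 (x, y)) :=
      Continuous.tendsto (by fun_prop) y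
    filter_upwards [hc.eventually (eventually_differentiableAt h)] with z hz
    exact pd_snd j hz
  have h2 := hasFDerivAt_fderiv_apply h (0, EuclideanSpace.single j 1)
  rw [pd_congr h1, pd_snd (f := fun p => fderiv ℝ f p (0, EuclideanSpace.single j 1)) i
    h2.differentiableAt, h2.fderiv]
  rfl

theorem pd_fst_pd_snd {f : EuclideanSpace ℝ (Fin n) × EuclideanSpace ℝ (Fin n) → ℝ}
    {x y : EuclideanSpace ℝ (Fin n)} (i j : Fin n) (h : ContDiffAt ℝ 2 f (x, y)) :
    pd i (fun x' => pd j (fun z' => f (x', z')) y) x =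
      fderiv ℝ (fderiv ℝ f) (x, y) (EuclideanSpace.single i 1, 0)
        (0, EuclideanSpace.single j 1) := by
  have h1 : (fun x' => pd j (fun z' => f (x', z')) y) =ᶠ[𝓝 x]
      fun x' => fderiv ℝ f (x', y) (0, EuclideanSpace.single j 1) := by
    have hc : Tendsto (fun z => (z, y)) (𝓝 x) (𝓝 (x, y)) :=
      Continuous.tendsto (by fun_prop) x
    filter_upwards [hc.eventually (eventually_differentiableAt h)] with z hz
    exact pd_snd j hz
  have h2 := hasFDerivAt_fderiv_apply h (0, EuclideanSpace.single j 1)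
  rw [pd_congr h1, pd_fst (f := fun p => fderiv ℝ f p (0, EuclideanSpace.single j 1)) i
    h2.differentiableAt, h2.fderiv]
  rfl

theorem fderiv_sq {f : V → ℝ} {p : V} (h : DifferentiableAt ℝ f p) (v : V) :
    fderiv ℝ (fun p' => f p' ^ 2) p v = 2 * f p * fderiv ℝ f p v := by
  have := h.hasFDerivAt.pow 2
  rw [this.fderiv]
  simp

theorem fderiv_fderiv_sq {f : V → ℝ} {p : V} (h : ContDiffAt ℝ 2 f p) (v w : V) :
    fderiv ℝ (fderiv ℝ (fun p' => f p' ^ 2)) p v w =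
      2 * f p * fderiv ℝ (fderiv ℝ f) p v w + 2 * fderiv ℝ f p v * fderiv ℝ f p w := by
  have hk : (fun p' => fderiv ℝ (fun p' => f p' ^ 2) p' w) =ᶠ[𝓝 p]
      fun p' => 2 * f p' * fderiv ℝ f p' w := by
    filter_upwards [eventually_differentiableAt h] with p' hp'
    exact fderiv_sq hp' w
  have hd : DifferentiableAt ℝ f p := h.differentiableAt (by norm_num)
  rw [fderiv_fderiv_eq_of_eventuallyEq (h.pow 2) hk
    ((hd.hasFDerivAt.const_mul 2).mul (hasFDerivAt_fderiv_apply h w))]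
  simp
  ring

/-- Half the fibre Hessian of F² is F F_yy + F_y ⊗ F_y; this form replaces the coordinate sums in
what follows. -/
theorem gInner_eq {F : EuclideanSpace ℝ (Fin n) → EuclideanSpace ℝ (Fin n) → ℝ}
    {x y : EuclideanSpace ℝ (Fin n)} (h : ContDiffAt ℝ 2
      (fun p : EuclideanSpace ℝ (Fin n) × EuclideanSpace ℝ (Fin n) => F p.1 p.2) (x, y))
    (u v : EuclideanSpace ℝ (Fin n)) :
    gInner F x y u v =
      F x y * fderiv ℝ (fderiv ℝ (fun p : EuclideanSpace ℝ (Fin n) × EuclideanSpace ℝ (Fin n) =>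
        F p.1 p.2)) (x, y) (0, u) (0, v) +
      fderiv ℝ (fun p : EuclideanSpace ℝ (Fin n) × EuclideanSpace ℝ (Fin n) => F p.1 p.2)
        (x, y) (0, u) *
      fderiv ℝ (fun p : EuclideanSpace ℝ (Fin n) × EuclideanSpace ℝ (Fin n) => F p.1 p.2)
        (x, y) (0, v) := by
  have h1 := fderiv_fderiv_sq h (0, u) (0, v)
  set H := fderiv ℝ (fderiv ℝ (fun p : EuclideanSpace ℝ (Fin n) × EuclideanSpace ℝ (Fin n) =>
    F p.1 p.2 ^ 2)) (x, y) with hH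
  have h2 : gInner F x y u v = 1 / 2 * H (0, u) (0, v) := by
    have e1 : ∀ i j, fundTensor F x y i j = 1 / 2 * H (0, EuclideanSpace.single i 1)
        (0, EuclideanSpace.single j 1) := fun i j => by
      rw [hH, ← pd_pd_snd (f := fun p => F p.1 p.2 ^ 2) i j (h.pow 2)]
      rfl
    rw [← sum_apply_snd H u, gInner]
    simp only [_root_.sum_apply, _root_.smul_apply, Finset.mul_sum]
    refine Finset.sum_congr rfl fun i _ => ?_
    rw [← sum_apply_snd (H (0, EuclideanSpace.single i 1)) v]
    simp only [Finset.mul_sum, e1, smul_eq_mul]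
    refine Finset.sum_congr rfl fun j _ => ?_
    ring
  rw [h2, h1]
  ring

end Calculus
end SphFinsler
end

/-! ### Sprays q x + P y: the Rapcsák equation and the Riemann operator, free of coordinates -/

noncomputable section
namespace SphFinsler

open Filter Topology

section Spray

variable {E : Type*} [NormedAddCommGroup E] [NormedSpace ℝ E]

/-- The slit tangent bundle of a subset of a vector space. -/
def slit (M : Set E) : Set (E × E) := M ×ˢ {y | y ≠ 0}

/-- The projective factor `P` of a Finsler function `f` with respect to the spray whose
coefficients are `q x`. -/
def projFactor (f q : E × E → ℝ) (p : E × E) : ℝ :=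
  fderiv ℝ f p (p.2, -(2 * q p) • p.1) / (2 * f p)

/-- The vector `q x + P y` of spray coefficients. -/
def sprayField (f q : E × E → ℝ) (p : E × E) : E := q p • p.1 + projFactor f q p • p.2

/-- The spray direction `(y, -2 G)`. -/
def sprayDir (f q : E × E → ℝ) (p : E × E) : E × E := (p.2, -(2 : ℝ) • sprayField f q p)

/-- A positive, positively homogeneous function `f` on the slit tangent bundle that satisfies the
Euler-Lagrange (Rapcsák) equation with respect to a spray with quadratic coefficients `q x`. -/
structure IsRapcsak (M : Set E) (f q : E × E → ℝ) : Prop where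
  isOpen : IsOpen M
  smooth : ContDiffOn ℝ ∞ f (slit M)
  smooth_q : ContDiffOn ℝ ∞ q (slit M)
  pos : ∀ p ∈ slit M, 0 < f p
  euler : ∀ p ∈ slit M, fderiv ℝ f p (0, p.2) = f p
  euler_q : ∀ p ∈ slit M, fderiv ℝ q p (0, p.2) = 2 * q p
  eulerLagrange : ∀ p ∈ slit M, ∀ v : E,
    fderiv ℝ (fderiv ℝ f) p (p.2, -(2 * q p) • p.1) (0, v) = fderiv ℝ f p (v, 0)

omit [NormedSpace ℝ E] in
theorem isOpen_slit {M : Set E} (hM : IsOpen M) : IsOpen (slit M) :=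
  hM.prod isOpen_ne

theorem two_le_infty : (2 : WithTop ℕ∞) ≤ ∞ := WithTop.coe_le_coe.2 le_top

/-- Splits off a multiple of the vertical field (0, y), along which derivatives are evaluated by
homogeneity. -/
theorem sprayDir_eq (f q : E × E → ℝ) (p : E × E) :
    sprayDir f q p = (p.2, -(2 * q p) • p.1) + -(2 * projFactor f q p) • ((0 : E), p.2) := by
  ext
  · simp [sprayDir]
  · simp only [sprayDir, sprayField, Prod.snd_add, Prod.smul_snd]
    module

theorem map_prod_split (L : E × E →L[ℝ] ℝ) (a b : E) :
    L (a, b) = L (a, 0) + L (0, b) := by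
  rw [← map_add]; simp

theorem map_zero_neg_two (L : E × E →L[ℝ] ℝ) (b : E) :
    L (0, -(2 : ℝ) • b) = -2 * L (0, b) := by
  rw [← smul_eq_mul, ← map_smul]
  simp

namespace IsRapcsak

variable {M : Set E} {f q : E × E → ℝ} (h : IsRapcsak M f q)
include h

theorem mem_nhds {p : E × E} (hp : p ∈ slit M) : slit M ∈ 𝓝 p :=
  (isOpen_slit h.isOpen).mem_nhds hp

theorem contDiffAt {p : E × E} (hp : p ∈ slit M) : ContDiffAt ℝ ∞ f p :=
  h.smooth.contDiffAt (h.mem_nhds hp)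

theorem contDiffAt_q {p : E × E} (hp : p ∈ slit M) : ContDiffAt ℝ ∞ q p :=
  h.smooth_q.contDiffAt (h.mem_nhds hp)

theorem contDiffAt_two {p : E × E} (hp : p ∈ slit M) : ContDiffAt ℝ 2 f p :=
  (h.contDiffAt hp).of_le two_le_infty

theorem contDiffAt_q_two {p : E × E} (hp : p ∈ slit M) : ContDiffAt ℝ 2 q p :=
  (h.contDiffAt_q hp).of_le two_le_infty

theorem contDiffAt_projFactor {p : E × E} (hp : p ∈ slit M) :
    ContDiffAt ℝ ∞ (projFactor f q) p := by
  have h1 : ContDiffAt ℝ ∞ (fderiv ℝ f) p := (h.contDiffAt hp).fderiv_right (by simp)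
  have h2 := h.contDiffAt_q hp
  have h3 := h.contDiffAt hp
  have h4 := (h.pos p hp).ne'
  unfold projFactor
  refine (h1.clm_apply ?_).div (contDiffAt_const.mul h3) (by positivity)
  exact contDiffAt_snd.prodMk ((contDiffAt_const.mul h2).neg.smul contDiffAt_fst)

theorem contDiffAt_projFactor_two {p : E × E} (hp : p ∈ slit M) :
    ContDiffAt ℝ 2 (projFactor f q) p :=
  (h.contDiffAt_projFactor hp).of_le two_le_infty

theorem contDiffAt_sprayField {p : E × E} (hp : p ∈ slit M) :
    ContDiffAt ℝ ∞ (sprayField f q) p :=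
  ((h.contDiffAt_q hp).smul contDiffAt_fst).add
    ((h.contDiffAt_projFactor hp).smul contDiffAt_snd)

theorem contDiffAt_sprayField_two {p : E × E} (hp : p ∈ slit M) :
    ContDiffAt ℝ 2 (sprayField f q) p :=
  (h.contDiffAt_sprayField hp).of_le two_le_infty

theorem hasFDerivAt {p : E × E} (hp : p ∈ slit M) : HasFDerivAt f (fderiv ℝ f p) p :=
  ((h.contDiffAt_two hp).differentiableAt (by norm_num)).hasFDerivAt

theorem hasFDerivAt_q {p : E × E} (hp : p ∈ slit M) : HasFDerivAt q (fderiv ℝ q p) p :=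
  ((h.contDiffAt_q_two hp).differentiableAt (by norm_num)).hasFDerivAt

theorem hasFDerivAt_projFactor {p : E × E} (hp : p ∈ slit M) :
    HasFDerivAt (projFactor f q) (fderiv ℝ (projFactor f q) p) p :=
  ((h.contDiffAt_projFactor_two hp).differentiableAt (by norm_num)).hasFDerivAt

theorem hasFDerivAt_sprayField {p : E × E} (hp : p ∈ slit M) :
    HasFDerivAt (sprayField f q) (fderiv ℝ (sprayField f q) p) p :=
  ((h.contDiffAt_sprayField_two hp).differentiableAt (by norm_num)).hasFDerivAt

theorem hasFDerivAt_fderiv {p : E × E} (hp : p ∈ slit M) :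
    HasFDerivAt (fderiv ℝ f) (fderiv ℝ (fderiv ℝ f) p) p :=
  (((h.contDiffAt_two hp).fderiv_right (m := 1) (by norm_num)).differentiableAt
    (by norm_num)).hasFDerivAt

/-- Differentiate Euler's relation F_y(y) = F in the direction w; the vertical part of w contributes
the same term to both sides. -/
theorem fderiv_fderiv_euler {p : E × E} (hp : p ∈ slit M) (w : E × E) :
    fderiv ℝ (fderiv ℝ f) p w (0, p.2) = fderiv ℝ f p (w.1, 0) := by
  have h1 : HasFDerivAt (fun p' : E × E => fderiv ℝ f p' (0, p'.2)) _ p :=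
    (h.hasFDerivAt_fderiv hp).clm_apply ((hasFDerivAt_const (0 : E) p).prodMk hasFDerivAt_snd)
  have h2 : (fun p' : E × E => fderiv ℝ f p' (0, p'.2)) =ᶠ[𝓝 p] f := by
    filter_upwards [h.mem_nhds hp] with p' hp' using h.euler p' hp'
  have h3 := congrArg (fun L : E × E →L[ℝ] ℝ => L w)
    ((h1.congr_of_eventuallyEq h2.symm).unique (h.hasFDerivAt hp))
  simp at h3
  have h4 : fderiv ℝ f p w = fderiv ℝ f p (w.1, 0) + fderiv ℝ f p (0, w.2) := by
    rw [← map_add]; simp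
  linarith

theorem fderiv_fderiv_euler_q {p : E × E} (hp : p ∈ slit M) (u : E) :
    fderiv ℝ (fderiv ℝ q) p (0, p.2) (0, u) = fderiv ℝ q p (0, u) := by
  have h0 : HasFDerivAt (fderiv ℝ q) (fderiv ℝ (fderiv ℝ q) p) p :=
    (((h.contDiffAt_q_two hp).fderiv_right (m := 1) (by norm_num)).differentiableAt
      (by norm_num)).hasFDerivAt
  have h1 : HasFDerivAt (fun p' : E × E => fderiv ℝ q p' (0, p'.2)) _ p :=
    h0.clm_apply ((hasFDerivAt_const (0 : E) p).prodMk hasFDerivAt_snd)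
  have h2 : (fun p' : E × E => fderiv ℝ q p' (0, p'.2)) =ᶠ[𝓝 p] fun p' => 2 * q p' := by
    filter_upwards [h.mem_nhds hp] with p' hp' using h.euler_q p' hp'
  have h3 := congrArg (fun L : E × E →L[ℝ] ℝ => L (0, u))
    ((h1.congr_of_eventuallyEq h2.symm).unique ((h.hasFDerivAt_q hp).const_mul 2))
  simp at h3
  rw [fderiv_fderiv_symm (h.contDiffAt_q_two hp)]
  linarith

theorem two_mul_projFactor {p : E × E} (hp : p ∈ slit M) :
    2 * f p * projFactor f q p = fderiv ℝ f p (p.2, -(2 * q p) • p.1) := by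
  have := (h.pos p hp).ne'
  unfold projFactor
  field_simp

theorem euler_projFactor {p : E × E} (hp : p ∈ slit M) :
    fderiv ℝ (projFactor f q) p (0, p.2) = projFactor f q p := by
  have h1 : HasFDerivAt (fun p' : E × E => fderiv ℝ f p' (p'.2, -(2 * q p') • p'.1)) _ p :=
    (h.hasFDerivAt_fderiv hp).clm_apply (hasFDerivAt_snd.prodMk
      (((h.hasFDerivAt_q hp).const_mul 2).neg.smul hasFDerivAt_fst))
  have h2 : (fun p' : E × E => fderiv ℝ f p' (p'.2, -(2 * q p') • p'.1)) =ᶠ[𝓝 p]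
      fun p' => 2 * f p' * projFactor f q p' := by
    filter_upwards [h.mem_nhds hp] with p' hp' using (h.two_mul_projFactor hp').symm
  have h3 := congrArg (fun L : E × E →L[ℝ] ℝ => L (0, p.2))
    ((h1.congr_of_eventuallyEq h2.symm).unique
      (((h.hasFDerivAt hp).const_mul 2).mul (h.hasFDerivAt_projFactor hp)))
  simp [h.euler p hp, h.euler_q p hp] at h3
  rw [fderiv_fderiv_symm (h.contDiffAt_two hp), h.fderiv_fderiv_euler hp] at h3
  have h4 := h.two_mul_projFactor hp
  -- Differentiating 2FP = dF(y, −2qx) along (0, y): the 2-homogeneity of q doubles the second slot,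
  -- and the mixed Euler relation supplies the extra (y, 0), so the argument doubles as a whole.
  have h5 : fderiv ℝ f p (p.2, -(2 * (2 * q p)) • p.1) + fderiv ℝ f p (p.2, 0) =
      2 * fderiv ℝ f p (p.2, -(2 * q p) • p.1) := by
    rw [← smul_eq_mul (2 : ℝ) (fderiv ℝ f p _), ← map_smul, ← map_add]
    congr 1
    ext
    · simp [two_smul]
    · simp only [Prod.mk_add_mk, Prod.smul_mk, smul_smul]
      module
  have h6 : 2 * f p * fderiv ℝ (projFactor f q) p (0, p.2) = 2 * f p * projFactor f q p := by
    simp only [neg_smul] at h5 h4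
    linarith
  exact mul_left_cancel₀ (by have := h.pos p hp; positivity) h6

/-- The Finsler function is constant along its spray. -/
theorem fderiv_sprayDir {p : E × E} (hp : p ∈ slit M) :
    fderiv ℝ f p (sprayDir f q p) = 0 := by
  rw [sprayDir_eq, map_add, map_smul, h.euler p hp, ← h.two_mul_projFactor hp, smul_eq_mul]
  ring

/-- Adding a multiple of (0, y) to the direction changes nothing, since F_yy(y, ·) = 0. This is why
P is free in the Rapcsák equation and can be chosen to make F constant along the spray. -/
theorem eulerLagrange_sprayDir {p : E × E} (hp : p ∈ slit M) (v : E) :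
    fderiv ℝ (fderiv ℝ f) p (sprayDir f q p) (0, v) = fderiv ℝ f p (v, 0) := by
  rw [sprayDir_eq, map_add, map_smul, add_apply,
    smul_apply, h.eulerLagrange p hp,
    fderiv_fderiv_symm (h.contDiffAt_two hp), h.fderiv_fderiv_euler hp]
  simp [Prod.mk_zero_zero]

theorem hasFDerivAt_sprayDir {p : E × E} (hp : p ∈ slit M) :
    HasFDerivAt (sprayDir f q) ((ContinuousLinearMap.snd ℝ E E).prod
      (-(2 : ℝ) • fderiv ℝ (sprayField f q) p)) p :=
  hasFDerivAt_snd.prodMk ((h.hasFDerivAt_sprayField hp).const_smul (-(2 : ℝ)))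

theorem fderiv_fderiv_sprayDir {p : E × E} (hp : p ∈ slit M) (w : E × E) :
    fderiv ℝ (fderiv ℝ f) p w (sprayDir f q p) +
      fderiv ℝ f p (w.2, -(2 : ℝ) • fderiv ℝ (sprayField f q) p w) = 0 := by
  have h1 : HasFDerivAt (fun p' : E × E => fderiv ℝ f p' (sprayDir f q p')) _ p :=
    (h.hasFDerivAt_fderiv hp).clm_apply (h.hasFDerivAt_sprayDir hp)
  have h2 : (fun p' : E × E => fderiv ℝ f p' (sprayDir f q p')) =ᶠ[𝓝 p] fun _ => 0 := by
    filter_upwards [h.mem_nhds hp] with p' hp' using h.fderiv_sprayDir hp'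
  have h3 := congrArg (fun L : E × E →L[ℝ] ℝ => L w)
    ((h1.congr_of_eventuallyEq h2.symm).unique (hasFDerivAt_const (0 : ℝ) p))
  simp at h3
  simpa [add_comm] using h3

/-- The horizontal derivative of the Finsler function vanishes. -/
theorem fderiv_horizontal {p : E × E} (hp : p ∈ slit M) (u : E) :
    fderiv ℝ f p (u, 0) = fderiv ℝ f p (0, fderiv ℝ (sprayField f q) p (0, u)) := by
  -- The fibre derivative of dF(y, −2G) = 0, with its second-order term replaced by Euler-Lagrange,
  -- reads 2F_x(u) − 2F_y(D_yG u) = 0.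
  have h1 := h.fderiv_fderiv_sprayDir hp (0, u)
  rw [fderiv_fderiv_symm (h.contDiffAt_two hp), h.eulerLagrange_sprayDir hp] at h1
  simp only at h1
  rw [map_prod_split _ u (-(2 : ℝ) • _), map_zero_neg_two] at h1
  linarith

theorem fderiv_fderiv_horizontal {p : E × E} (hp : p ∈ slit M) (u : E) :
    fderiv ℝ (fderiv ℝ f) p (u, 0) (sprayDir f q p) =
      2 * fderiv ℝ f p (0, fderiv ℝ (sprayField f q) p (u, 0)) := by
  have h1 := h.fderiv_fderiv_sprayDir hp (u, 0)
  simp only at h1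
  rw [map_zero_neg_two] at h1
  linarith

end IsRapcsak

/-- The Riemann curvature operator of the spray with coefficients `q x + P y`. -/
def riemannOp (f q : E × E → ℝ) (p : E × E) (u : E) : E :=
  (2 : ℝ) • fderiv ℝ (sprayField f q) p (u, 0)
    - fderiv ℝ (fderiv ℝ (sprayField f q)) p (sprayDir f q p) (0, u)
    - fderiv ℝ (sprayField f q) p (0, fderiv ℝ (sprayField f q) p (0, u))

/-- The obstruction for the spray with coefficients `q x` to have isotropic curvature. -/
def weylDefect (q : E × E → ℝ) (p : E × E) (u : E) : ℝ :=
  2 * fderiv ℝ q p (u, 0) - fderiv ℝ (fderiv ℝ q) p (p.2, -(2 * q p) • p.1) (0, u)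
    - fderiv ℝ q p (0, u) * fderiv ℝ q p (0, p.1)

/-- The scalar part of the Riemann curvature operator. -/
def ricciFactor (f q : E × E → ℝ) (p : E × E) : ℝ :=
  2 * q p - fderiv ℝ (projFactor f q) p (sprayDir f q p) - projFactor f q p ^ 2

namespace IsRapcsak

variable {M : Set E} {f q : E × E → ℝ} (h : IsRapcsak M f q)
include h

/-- Differentiating the horizontal relation F_x(u) = F_y(D_yG u) along the spray produces exactly
F_y of the three terms of the Riemann operator. -/
theorem fderiv_riemannOp {p : E × E} (hp : p ∈ slit M) (u : E) :
    fderiv ℝ f p (0, riemannOp f q p u) = 0 := by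
  have h0 : HasFDerivAt (fun p' => fderiv ℝ (sprayField f q) p' (0, u)) _ p :=
    hasFDerivAt_fderiv_apply (h.contDiffAt_sprayField_two hp) (0, u)
  have h1 : HasFDerivAt
      (fun p' : E × E => fderiv ℝ f p' (0, fderiv ℝ (sprayField f q) p' (0, u))) _ p :=
    (h.hasFDerivAt_fderiv hp).clm_apply ((hasFDerivAt_const (0 : E) p).prodMk h0)
  have h2 : (fun p' : E × E => fderiv ℝ f p' (u, 0)) =ᶠ[𝓝 p]
      fun p' : E × E => fderiv ℝ f p' (0, fderiv ℝ (sprayField f q) p' (0, u)) := by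
    filter_upwards [h.mem_nhds hp] with p' hp' using h.fderiv_horizontal hp' u
  have h3 := fderiv_fderiv_eq_of_eventuallyEq (h.contDiffAt_two hp) h2 h1 (sprayDir f q p)
  simp at h3
  rw [h.eulerLagrange_sprayDir hp, h.fderiv_horizontal hp,
    fderiv_fderiv_symm (h.contDiffAt_two hp), h.fderiv_fderiv_horizontal hp] at h3
  have h4 : ∀ a b c : E, fderiv ℝ f p (0, (2 : ℝ) • a - b - c) =
      2 * fderiv ℝ f p (0, a) - fderiv ℝ f p (0, b) - fderiv ℝ f p (0, c) := fun a b c => by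
    rw [← smul_eq_mul, ← map_smul, ← map_sub, ← map_sub]
    simp
  rw [riemannOp, h4]
  linarith

theorem fderiv_sprayField {p : E × E} (hp : p ∈ slit M) (w : E × E) :
    fderiv ℝ (sprayField f q) p w = q p • w.1 + fderiv ℝ q p w • p.1 +
      (projFactor f q p • w.2 + fderiv ℝ (projFactor f q) p w • p.2) := by
  have h1 : HasFDerivAt (sprayField f q) _ p :=
    ((h.hasFDerivAt_q hp).smul hasFDerivAt_fst).add
      ((h.hasFDerivAt_projFactor hp).smul hasFDerivAt_snd)
  rw [h1.fderiv]
  simp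

theorem fderiv_fderiv_sprayField {p : E × E} (hp : p ∈ slit M) (v w : E × E) :
    fderiv ℝ (fderiv ℝ (sprayField f q)) p v w =
      fderiv ℝ q p v • w.1 +
      (fderiv ℝ q p w • v.1 + fderiv ℝ (fderiv ℝ q) p v w • p.1) +
      (fderiv ℝ (projFactor f q) p v • w.2 +
      (fderiv ℝ (projFactor f q) p w • v.2 +
        fderiv ℝ (fderiv ℝ (projFactor f q)) p v w • p.2)) := by
  have h1 : (fun p' => fderiv ℝ (sprayField f q) p' w) =ᶠ[𝓝 p] fun p' =>
      q p' • w.1 + fderiv ℝ q p' w • p'.1 +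
      (projFactor f q p' • w.2 + fderiv ℝ (projFactor f q) p' w • p'.2) := by
    filter_upwards [h.mem_nhds hp] with p' hp' using h.fderiv_sprayField hp' w
  have h2 := hasFDerivAt_fderiv_apply (h.contDiffAt_q_two hp) w
  have h3 := hasFDerivAt_fderiv_apply (h.contDiffAt_projFactor_two hp) w
  rw [fderiv_fderiv_eq_of_eventuallyEq (h.contDiffAt_sprayField_two hp) h1
    ((((h.hasFDerivAt_q hp).smul_const w.1).add (h2.smul hasFDerivAt_fst)).add
    (((h.hasFDerivAt_projFactor hp).smul_const w.2).add (h3.smul hasFDerivAt_snd)))]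
  simp

/-- Every term of the operator of q x + P y is a multiple of u, y or x. The contributions of P to
the x-coefficient cancel by homogeneity of q, leaving `weylDefect`. -/
theorem exists_riemannOp_eq {p : E × E} (hp : p ∈ slit M) (u : E)
    (hq : weylDefect q p u • p.1 = 0) :
    ∃ τ : ℝ, riemannOp f q p u = ricciFactor f q p • u + τ • p.2 := by
  -- The witness is the collected coefficient of y.
  refine ⟨2 * fderiv ℝ (projFactor f q) p (u, 0) - fderiv ℝ q p (0, u)
    - fderiv ℝ (fderiv ℝ (projFactor f q)) p (sprayDir f q p) (0, u)
    + 2 * projFactor f q p * fderiv ℝ (projFactor f q) p (0, u)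
    - fderiv ℝ (projFactor f q) p (0, fderiv ℝ (sprayField f q) p (0, u))
    - projFactor f q p * fderiv ℝ (projFactor f q) p (0, u), ?_⟩
  have e1 : fderiv ℝ q p (0, fderiv ℝ (sprayField f q) p (0, u)) =
      fderiv ℝ q p (0, u) * fderiv ℝ q p (0, p.1) + projFactor f q p * fderiv ℝ q p (0, u) +
        fderiv ℝ (projFactor f q) p (0, u) * (2 * q p) := by
    rw [h.fderiv_sprayField hp, ← h.euler_q p hp, ← smul_eq_mul, ← smul_eq_mul, ← smul_eq_mul,
      ← map_smul, ← map_smul, ← map_smul, ← map_add, ← map_add]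
    congr 1
    simp [add_assoc]
  have e2 : fderiv ℝ (fderiv ℝ q) p (sprayDir f q p) (0, u) =
      fderiv ℝ (fderiv ℝ q) p (p.2, -(2 * q p) • p.1) (0, u) -
        2 * projFactor f q p * fderiv ℝ q p (0, u) := by
    rw [sprayDir_eq, map_add, map_smul, add_apply,
      smul_apply, h.fderiv_fderiv_euler_q hp, smul_eq_mul]
    ring
  have e3 : (sprayDir f q p).1 = p.2 := rfl
  have e4 : (sprayDir f q p).2 = -(2 * q p) • p.1 - (2 * projFactor f q p) • p.2 := by
    simp only [sprayDir, sprayField]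
    module
  rw [riemannOp, h.fderiv_sprayField hp (u, 0), h.fderiv_fderiv_sprayField hp,
    h.fderiv_sprayField hp (0, fderiv ℝ (sprayField f q) p (0, u)), e1, e2, e3, e4]
  have e5 := h.fderiv_sprayField hp (0, u)
  simp only at e5 ⊢
  rw [weylDefect] at hq
  set X := fderiv ℝ (fderiv ℝ q) p (p.2, -(2 * q p) • p.1) (0, u)
  set N := fderiv ℝ (projFactor f q) p (0, fderiv ℝ (sprayField f q) p (0, u))
  rw [e5, ricciFactor, ← sub_eq_zero]
  refine Eq.trans ?_ hq
  module

end IsRapcsak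
end Spray
end SphFinsler
end

/-! ### From the coordinate definitions to the operators above: Douglas tensor and flag curvature -/

noncomputable section
namespace SphFinsler

open Filter Topology

section Coordinates

variable {n : ℕ} {M : Set (EuclideanSpace ℝ (Fin n))}
  {F : EuclideanSpace ℝ (Fin n) → EuclideanSpace ℝ (Fin n) → ℝ}
  {q : EuclideanSpace ℝ (Fin n) × EuclideanSpace ℝ (Fin n) → ℝ}

theorem dotProduct_fundTensor_mulVec (x y u v : EuclideanSpace ℝ (Fin n)) :
    dotProduct u ((fundTensor F x y).mulVec v) = gInner F x y u v := by
  simp only [dotProduct, Matrix.mulVec, gInner, Finset.mul_sum]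
  refine Finset.sum_congr rfl fun i _ => Finset.sum_congr rfl fun j _ => ?_
  ring

theorem IsFinslerMetric.isUnit_det (hF : IsFinslerMetric M F) {x y : EuclideanSpace ℝ (Fin n)}
    (hx : x ∈ M) (hy : y ≠ 0) : IsUnit (fundTensor F x y).det := by
  rw [isUnit_iff_ne_zero]
  intro h0
  obtain ⟨v, hv, hv0⟩ := Matrix.exists_mulVec_eq_zero_iff.2 h0
  have h1 := hF.posDef x hx y hy (WithLp.toLp 2 v) (by simpa using hv)
  rw [← dotProduct_fundTensor_mulVec] at h1
  simp [hv0] at h1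

/-- The spray coefficients of a solution of the Rapcsák equation. -/
theorem spray_eq (hF : IsFinslerMetric M F) (h : IsRapcsak M (fun p => F p.1 p.2) q)
    {x y : EuclideanSpace ℝ (Fin n)} (hp : (x, y) ∈ slit M) (i : Fin n) :
    spray F i x y = sprayField (fun p => F p.1 p.2) q (x, y) i := by
  set f : EuclideanSpace ℝ (Fin n) × EuclideanSpace ℝ (Fin n) → ℝ := fun p => F p.1 p.2 with hf
  set G := sprayField f q (x, y) with hG
  have hc := h.contDiffAt_two hp
  -- Euler-Lagrange for F² along (y, −2G), on which F is constant, is the linear system whose matrix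
  -- is the fundamental tensor; positive definiteness then permits inversion.
  have e1 : ∀ l, (∑ k, y k * pd k (fun x' => pd l (fun y' => F x' y' ^ 2) y) x)
      - pd l (fun x' => F x' y ^ 2) x = 4 * (fundTensor F x y).mulVec G l := by
    intro l
    have a1 : ∀ k, pd k (fun x' => pd l (fun y' => F x' y' ^ 2) y) x =
        fderiv ℝ (fderiv ℝ (fun p => f p ^ 2)) (x, y) (EuclideanSpace.single k 1, 0)
          (0, EuclideanSpace.single l 1) := fun k =>
      pd_fst_pd_snd (f := fun p => f p ^ 2) k l (hc.pow 2)
    have a2 : pd l (fun x' => F x' y ^ 2) x =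
        fderiv ℝ (fun p => f p ^ 2) (x, y) (EuclideanSpace.single l 1, 0) :=
      pd_fst (f := fun p => f p ^ 2) l ((hc.pow 2).differentiableAt (by norm_num))
    have a3 : (fundTensor F x y).mulVec G l = gInner F x y (EuclideanSpace.single l 1) G := by
      rw [← dotProduct_fundTensor_mulVec]
      simp [dotProduct]
    have a4 := sum_apply_fst (fderiv ℝ (fderiv ℝ (fun p => f p ^ 2)) (x, y)) y
    have a5 := congrArg (fun L => L (0, EuclideanSpace.single l 1)) a4
    simp only [_root_.sum_apply, _root_.smul_apply, smul_eq_mul] at a5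
    simp only [a1, a2, a3]
    rw [a5, gInner_eq hc, fderiv_fderiv_sq hc, fderiv_sq (hc.differentiableAt (by norm_num))]
    have b1 := h.eulerLagrange_sprayDir hp (EuclideanSpace.single l 1)
    have b2 := h.fderiv_sprayDir hp
    have b3 : sprayDir f q (x, y) = (y, 0) + -(2 : ℝ) • (0, G) := by
      ext j
      · simp [sprayDir]
      · simp [sprayDir, hG]
    rw [b3, map_add, map_smul] at b1 b2
    rw [add_apply, smul_apply] at b1
    simp only [smul_eq_mul] at b1 b2
    rw [fderiv_fderiv_symm hc (0, EuclideanSpace.single l 1)]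
    change 2 * F x y * fderiv ℝ (fderiv ℝ f) (x, y) (y, 0) (0, EuclideanSpace.single l 1) + _
      - 2 * F x y * _ = 4 * (F x y * fderiv ℝ (fderiv ℝ f) (x, y) (0, G) _ + _ * _)
    linear_combination 2 * F x y * b1 +
      2 * fderiv ℝ f (x, y) (0, EuclideanSpace.single l 1) * b2
  have e2 := hF.isUnit_det hp.1 hp.2
  have e3 : ((fundTensor F x y)⁻¹).mulVec ((fundTensor F x y).mulVec G) = G := by
    rw [Matrix.mulVec_mulVec, Matrix.nonsing_inv_mul _ e2, Matrix.one_mulVec]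
  rw [spray]
  simp only [e1]
  have e4 := congrFun e3 i
  rw [← e4, Matrix.mulVec, dotProduct, Finset.mul_sum]
  refine Finset.sum_congr rfl fun l _ => ?_
  ring

theorem eventually_snd_mem_slit (hM : IsOpen M) {x y : EuclideanSpace ℝ (Fin n)}
    (hp : (x, y) ∈ slit M) : ∀ᶠ z in 𝓝 y, (x, z) ∈ slit M :=
  (Continuous.tendsto (by fun_prop : Continuous fun z => (x, z)) y).eventually
    ((isOpen_slit hM).mem_nhds hp)

theorem eventually_fst_mem_slit (hM : IsOpen M) {x y : EuclideanSpace ℝ (Fin n)}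
    (hp : (x, y) ∈ slit M) : ∀ᶠ z in 𝓝 x, (z, y) ∈ slit M :=
  (Continuous.tendsto (by fun_prop : Continuous fun z => (z, y)) x).eventually
    ((isOpen_slit hM).mem_nhds hp)

theorem pd_bilin_diag (B : EuclideanSpace ℝ (Fin n) →L[ℝ] EuclideanSpace ℝ (Fin n) →L[ℝ] ℝ)
    (l : Fin n) (z : EuclideanSpace ℝ (Fin n)) :
    pd l (fun z => B z z) z = B z (EuclideanSpace.single l 1) + B (EuclideanSpace.single l 1) z := by
  have h1 : HasFDerivAt (fun z => B z z) _ z := B.hasFDerivAt.clm_apply (hasFDerivAt_id z)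
  simp [pd, h1.fderiv]

theorem pd_pd_pd_bilin_diag
    (B : EuclideanSpace ℝ (Fin n) →L[ℝ] EuclideanSpace ℝ (Fin n) →L[ℝ] ℝ)
    (j k l : Fin n) (z : EuclideanSpace ℝ (Fin n)) :
    pd j (pd k (pd l (fun z => B z z))) z = 0 := by
  have h1 : pd l (fun z => B z z) = fun z =>
      (B.flip (EuclideanSpace.single l 1) + B (EuclideanSpace.single l 1)) z := by
    funext z
    simp [pd_bilin_diag]
  have h2 : pd k (pd l (fun z => B z z)) = fun _ =>
      (B.flip (EuclideanSpace.single l 1) + B (EuclideanSpace.single l 1))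
        (EuclideanSpace.single k 1) := by
    funext z
    rw [h1, pd, ContinuousLinearMap.fderiv]
  rw [h2]
  simp [pd]

theorem hasFDerivAt_sprayField_apply (h : IsRapcsak M (fun p => F p.1 p.2) q)
    {p : EuclideanSpace ℝ (Fin n) × EuclideanSpace ℝ (Fin n)} (hp : p ∈ slit M) (i : Fin n) :
    HasFDerivAt (fun p' => sprayField (fun p => F p.1 p.2) q p' i)
      ((EuclideanSpace.proj i).comp (fderiv ℝ (sprayField (fun p => F p.1 p.2) q) p)) p :=
  (EuclideanSpace.proj (𝕜 := ℝ) i).hasFDerivAt.comp p (h.hasFDerivAt_sprayField hp)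

theorem pd_spray_snd (hF : IsFinslerMetric M F) (h : IsRapcsak M (fun p => F p.1 p.2) q)
    {x y : EuclideanSpace ℝ (Fin n)} (hp : (x, y) ∈ slit M) (i k : Fin n) :
    pd k (spray F i x) y = fderiv ℝ (sprayField (fun p => F p.1 p.2) q) (x, y)
      (0, EuclideanSpace.single k 1) i := by
  have h1 : spray F i x =ᶠ[𝓝 y] fun z => sprayField (fun p => F p.1 p.2) q (x, z) i := by
    filter_upwards [eventually_snd_mem_slit h.isOpen hp] with z hz using spray_eq hF h hz i
  have h2 := hasFDerivAt_sprayField_apply h hp i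
  rw [pd_congr h1, pd_snd (f := fun p => sprayField (fun p => F p.1 p.2) q p i) k
    h2.differentiableAt, h2.fderiv]
  rfl

theorem pd_spray_fst (hF : IsFinslerMetric M F) (h : IsRapcsak M (fun p => F p.1 p.2) q)
    {x y : EuclideanSpace ℝ (Fin n)} (hp : (x, y) ∈ slit M) (i k : Fin n) :
    pd k (fun x' => spray F i x' y) x = fderiv ℝ (sprayField (fun p => F p.1 p.2) q) (x, y)
      (EuclideanSpace.single k 1, 0) i := by
  have h1 : (fun x' => spray F i x' y) =ᶠ[𝓝 x]
      fun z => sprayField (fun p => F p.1 p.2) q (z, y) i := by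
    filter_upwards [eventually_fst_mem_slit h.isOpen hp] with z hz using spray_eq hF h hz i
  have h2 := hasFDerivAt_sprayField_apply h hp i
  rw [pd_congr h1, pd_fst (f := fun p => sprayField (fun p => F p.1 p.2) q p i) k
    h2.differentiableAt, h2.fderiv]
  rfl

theorem hasFDerivAt_fderiv_sprayField_apply (h : IsRapcsak M (fun p => F p.1 p.2) q)
    {p : EuclideanSpace ℝ (Fin n) × EuclideanSpace ℝ (Fin n)} (hp : p ∈ slit M) (i : Fin n)
    (w : EuclideanSpace ℝ (Fin n) × EuclideanSpace ℝ (Fin n)) :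
    HasFDerivAt (fun p' => fderiv ℝ (sprayField (fun p => F p.1 p.2) q) p' w i)
      ((EuclideanSpace.proj i).comp
        ((fderiv ℝ (fderiv ℝ (sprayField (fun p => F p.1 p.2) q)) p).flip w)) p :=
  (EuclideanSpace.proj (𝕜 := ℝ) i).hasFDerivAt.comp p
    (hasFDerivAt_fderiv_apply (h.contDiffAt_sprayField_two hp) w)

theorem pd_pd_spray_snd (hF : IsFinslerMetric M F) (h : IsRapcsak M (fun p => F p.1 p.2) q)
    {x y : EuclideanSpace ℝ (Fin n)} (hp : (x, y) ∈ slit M) (i j k : Fin n) :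
    pd j (pd k (spray F i x)) y =
      fderiv ℝ (fderiv ℝ (sprayField (fun p => F p.1 p.2) q)) (x, y)
        (0, EuclideanSpace.single j 1) (0, EuclideanSpace.single k 1) i := by
  have h1 : pd k (spray F i x) =ᶠ[𝓝 y] fun z =>
      fderiv ℝ (sprayField (fun p => F p.1 p.2) q) (x, z) (0, EuclideanSpace.single k 1) i := by
    filter_upwards [eventually_snd_mem_slit h.isOpen hp] with z hz using pd_spray_snd hF h hz i k
  have h2 := hasFDerivAt_fderiv_sprayField_apply h hp i (0, EuclideanSpace.single k 1)
  rw [pd_congr h1, pd_snd (f := fun p => fderiv ℝ (sprayField (fun p => F p.1 p.2) q) p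
    (0, EuclideanSpace.single k 1) i) j h2.differentiableAt, h2.fderiv]
  rfl

theorem pd_fst_pd_spray_snd (hF : IsFinslerMetric M F)
    (h : IsRapcsak M (fun p => F p.1 p.2) q)
    {x y : EuclideanSpace ℝ (Fin n)} (hp : (x, y) ∈ slit M) (i j k : Fin n) :
    pd j (fun x' => pd k (spray F i x') y) x =
      fderiv ℝ (fderiv ℝ (sprayField (fun p => F p.1 p.2) q)) (x, y)
        (EuclideanSpace.single j 1, 0) (0, EuclideanSpace.single k 1) i := by
  have h1 : (fun x' => pd k (spray F i x') y) =ᶠ[𝓝 x] fun z =>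
      fderiv ℝ (sprayField (fun p => F p.1 p.2) q) (z, y) (0, EuclideanSpace.single k 1) i := by
    filter_upwards [eventually_fst_mem_slit h.isOpen hp] with z hz using pd_spray_snd hF h hz i k
  have h2 := hasFDerivAt_fderiv_sprayField_apply h hp i (0, EuclideanSpace.single k 1)
  rw [pd_congr h1, pd_fst (f := fun p => fderiv ℝ (sprayField (fun p => F p.1 p.2) q) p
    (0, EuclideanSpace.single k 1) i) j h2.differentiableAt, h2.fderiv]
  rfl

/-- The divergence of the spray coefficients in the fibre. -/
theorem sum_pd_spray (hF : IsFinslerMetric M F) (h : IsRapcsak M (fun p => F p.1 p.2) q)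
    {x y : EuclideanSpace ℝ (Fin n)} (hp : (x, y) ∈ slit M) :
    ∑ m, pd m (spray F m x) y = fderiv ℝ q (x, y) (0, x) +
      ((n : ℝ) + 1) * projFactor (fun p => F p.1 p.2) q (x, y) := by
  simp only [pd_spray_snd hF h hp, h.fderiv_sprayField hp]
  -- The trace of dq ⊗ x + P id + dP ⊗ y: the last term gives dP(y) = P, whence n + 1 instead of n.
  have h1 := sum_apply_snd (fderiv ℝ q (x, y)) x
  have h2 := sum_apply_snd (fderiv ℝ (projFactor (fun p => F p.1 p.2) q) (x, y)) y
  have h3 := h.euler_projFactor hp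
  simp only at h3
  rw [h3] at h2
  simp only [smul_eq_mul] at h1 h2
  simp [Finset.sum_add_distrib]
  rw [← h1]
  simp_rw [mul_comm _ (y _), mul_comm _ (x _)]
  linarith

theorem hasZeroDouglasCurvature_of_isRapcsak (hF : IsFinslerMetric M F)
    (h : IsRapcsak M (fun p => F p.1 p.2) q)
    (hq : ∀ x ∈ M, ∃ B : EuclideanSpace ℝ (Fin n) →L[ℝ] EuclideanSpace ℝ (Fin n) →L[ℝ] ℝ,
      ∀ y, y ≠ 0 → q (x, y) = B y y) : HasZeroDouglasCurvature M F := by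
  intro x hx y hy j i k l
  obtain ⟨B, hB⟩ := hq x hx
  have h1 : ∀ z, z ≠ 0 → fderiv ℝ q (x, z) (0, x) = B z x + B x z := by
    intro z hz
    have hp : (x, z) ∈ slit M := ⟨hx, hz⟩
    have a1 : HasFDerivAt (fun z => q (x, z))
        ((fderiv ℝ q (x, z)).comp (ContinuousLinearMap.inr ℝ _ _)) z :=
      (h.hasFDerivAt_q hp).comp z (hasFDerivAt_prodMk_right x z)
    have a2 : HasFDerivAt (fun z => B z z) _ z := B.hasFDerivAt.clm_apply (hasFDerivAt_id z)
    have a3 : (fun z => q (x, z)) =ᶠ[𝓝 z] fun z => B z z := by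
      filter_upwards [isOpen_ne.mem_nhds hz] with w hw using hB w hw
    have a4 := congrArg (fun L => L x) ((a2.congr_of_eventuallyEq a3).unique a1)
    simp at a4
    exact a4.symm
  -- The terms P yⁱ cancel against the divergence; this bilinear form is what is left.
  set B' : EuclideanSpace ℝ (Fin n) →L[ℝ] EuclideanSpace ℝ (Fin n) →L[ℝ] ℝ :=
    x i • B - (1 / ((n : ℝ) + 1)) • (B.flip x + B x).smulRight (EuclideanSpace.proj (𝕜 := ℝ) i)
    with hB'
  set D : EuclideanSpace ℝ (Fin n) → ℝ := fun z =>
    spray F i x z - 1 / ((n : ℝ) + 1) * (∑ m, pd m (spray F m x) z) * z i with hD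
  have h2 : ∀ z, z ≠ 0 → D z = B' z z := by
    intro z hz
    have hp : (x, z) ∈ slit M := ⟨hx, hz⟩
    have hn : (n : ℝ) + 1 ≠ 0 := by positivity
    simp only [hD, hB']
    rw [sum_pd_spray hF h hp, spray_eq hF h hp, h1 z hz]
    simp [sprayField, hB z hz]
    field_simp
    ring
  have h3 : ∀ (m : Fin n) (a b : EuclideanSpace ℝ (Fin n) → ℝ), (∀ z, z ≠ 0 → a z = b z) →
      ∀ z, z ≠ 0 → pd m a z = pd m b z := by
    intro m a b hab z hz
    refine pd_congr ?_
    filter_upwards [isOpen_ne.mem_nhds hz] with w hw using hab w hw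
  exact (h3 j _ _ (h3 k _ _ (h3 l _ _ h2)) y hy).trans (pd_pd_pd_bilin_diag B' j k l y)

/-- The two sums containing second derivatives of G are together one derivative along (y, −2G). -/
theorem riemann_mulVec (hF : IsFinslerMetric M F) (h : IsRapcsak M (fun p => F p.1 p.2) q)
    {x y : EuclideanSpace ℝ (Fin n)} (hp : (x, y) ∈ slit M) (u : EuclideanSpace ℝ (Fin n)) :
    WithLp.toLp 2 ((riemann F x y).mulVec u) = riemannOp (fun p => F p.1 p.2) q (x, y) u := by
  set f : EuclideanSpace ℝ (Fin n) × EuclideanSpace ℝ (Fin n) → ℝ := fun p => F p.1 p.2 with hf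
  set dG := fderiv ℝ (sprayField f q) (x, y) with hdG
  set d2G := fderiv ℝ (fderiv ℝ (sprayField f q)) (x, y) with hd2G
  have e1 : ∀ i k, riemann F x y i k =
      riemannOp f q (x, y) (EuclideanSpace.single k 1) i := by
    intro i k
    have a1 := congrArg (fun L => L (0, EuclideanSpace.single k 1) i) (sum_apply_fst d2G y)
    have a2 := congrArg (fun L => L (0, EuclideanSpace.single k 1) i)
      (sum_apply_snd d2G (sprayField f q (x, y)))
    have a3 := congrArg (fun w : EuclideanSpace ℝ (Fin n) => w i)
      (sum_apply_snd dG (dG (0, EuclideanSpace.single k 1)))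
    simp [_root_.sum_apply] at a1 a2 a3
    have b3 : sprayDir f q (x, y) = (y, 0) + -(2 : ℝ) • (0, sprayField f q (x, y)) := by
      ext j
      · simp [sprayDir]
      · simp [sprayDir]
    simp only [riemann, Matrix.of_apply, pd_spray_fst hF h hp, pd_spray_snd hF h hp,
      pd_pd_spray_snd hF h hp, pd_fst_pd_spray_snd hF h hp, spray_eq hF h hp]
    simp only [← hf, ← hdG, ← hd2G]
    rw [riemannOp, b3, map_add, map_smul, ← hd2G, ← hdG, a1, a2]
    simp only [mul_comm (dG (0, EuclideanSpace.single _ 1) i), a3]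
    simp
    ring
  ext i
  have e2 : ∀ v w : EuclideanSpace ℝ (Fin n), ∀ c : ℝ, riemannOp f q (x, y) (c • v + w) =
      c • riemannOp f q (x, y) v + riemannOp f q (x, y) w := by
    intro v w c
    have c1 : ((c • v + w, 0) : EuclideanSpace ℝ (Fin n) × EuclideanSpace ℝ (Fin n)) =
      c • (v, 0) + (w, 0) := by simp
    have c2 : ∀ v w : EuclideanSpace ℝ (Fin n),
      ((0, c • v + w) : EuclideanSpace ℝ (Fin n) × EuclideanSpace ℝ (Fin n)) =
      c • (0, v) + (0, w) := by simp
    simp only [riemannOp, c1, c2, map_add, map_smul]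
    module
  let R : EuclideanSpace ℝ (Fin n) →ₗ[ℝ] EuclideanSpace ℝ (Fin n) :=
    { toFun := riemannOp f q (x, y)
      map_add' := fun v w => by simpa using e2 v w 1
      map_smul' := fun c v => by
        have z : riemannOp f q (x, y) 0 = 0 := by simpa using e2 0 0 1
        simpa [z] using e2 v 0 c }
  change ∑ k, riemann F x y i k * u k = R u i
  conv_rhs => rw [← sum_smul_single u]
  rw [map_sum]
  simp only [map_smul, e1]
  simp [R, mul_comm]

/-- If u is sent to κu + τy, then F_y of the image being 0 gives τF = −κF_y(u). The numerator of K
becomes κ(g_y(u, u) − F_y(u)²) and the denominator is F²(g_y(u, u) − F_y(u)²). -/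
theorem isOfScalarFlagCurvature_of_isRapcsak (hF : IsFinslerMetric M F)
    (h : IsRapcsak M (fun p => F p.1 p.2) q)
    (hq : ∀ p ∈ slit M, ∀ u, weylDefect q p u • p.1 = 0) : IsOfScalarFlagCurvature M F := by
  refine ⟨fun x y => ricciFactor (fun p => F p.1 p.2) q (x, y) / F x y ^ 2, ?_⟩
  intro x hx y u hyu
  have hy : y ≠ 0 := hyu.ne_zero 0
  have hp : (x, y) ∈ slit M := ⟨hx, hy⟩
  have hpos : 0 < F x y := h.pos _ hp
  obtain ⟨τ, hτ⟩ := h.exists_riemannOp_eq hp u (hq _ hp u)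
  have h1 := h.fderiv_riemannOp hp u
  have hc := h.contDiffAt_two hp
  have hgg := @gInner_eq n F x y hc
  set f : EuclideanSpace ℝ (Fin n) × EuclideanSpace ℝ (Fin n) → ℝ := fun p => F p.1 p.2 with hf
  set κ := ricciFactor f q (x, y)
  have hsplit : ∀ (a b : ℝ) (v w : EuclideanSpace ℝ (Fin n)),
      ((0, a • v + b • w) : EuclideanSpace ℝ (Fin n) × EuclideanSpace ℝ (Fin n)) =
      a • (0, v) + b • (0, w) := by simp
  have hE := h.euler _ hp
  simp only at hE
  have hE2 : ∀ v, fderiv ℝ (fderiv ℝ f) (x, y) (0, y) (0, v) = 0 := by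
    intro v
    rw [fderiv_fderiv_symm hc]
    have := h.fderiv_fderiv_euler hp (0, v)
    simp only at this
    rw [this, Prod.mk_zero_zero, map_zero]
  simp only at hτ
  rw [hτ, hsplit, map_add, map_smul, map_smul, hE] at h1
  rw [flagCurvature, riemann_mulVec hF h hp, hτ]
  have g1 : gInner F x y (κ • u + τ • y) u = κ * gInner F x y u u + τ * gInner F x y y u := by
    rw [hgg, hgg, hgg, hsplit, map_add, map_add, map_smul, map_smul, map_smul, map_smul]
    simp only [add_apply, smul_apply, smul_eq_mul]
    ring
  have g2 : gInner F x y y u = F x y * fderiv ℝ f (x, y) (0, u) := by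
    rw [hgg, hE2, hE]
    simp [hf]
  have g3 : gInner F x y y y = F x y ^ 2 := by
    rw [hgg, hE2, hE]
    simp [hf, sq]
  -- This vector is g_y-orthogonal to y, and its squared g_y-length is the denominator of the flag
  -- curvature.
  have hne : F x y • u + (-(fderiv ℝ f (x, y) (0, u))) • y ≠ 0 := by
    intro h0
    have := LinearIndependent.pair_iff.1 hyu _ _ ((add_comm _ _).trans h0)
    exact hpos.ne' this.2
  have hden : 0 < gInner F x y y y * gInner F x y u u - gInner F x y y u ^ 2 := by
    have := hF.posDef x hx y hy _ hne
    rw [hgg, hsplit] at this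
    simp only [map_add, map_smul, add_apply, smul_apply, smul_eq_mul, hE, hE2] at this
    rw [fderiv_fderiv_symm hc (0, u) (0, y), hE2] at this
    rw [g3, g2, hgg]
    simp only [hf] at this ⊢
    ring_nf at this ⊢
    exact this
  rw [div_eq_div_iff hden.ne' (by positivity), g1, g2, g3]
  simp only [smul_eq_mul, hf] at h1 ⊢
  linear_combination F x y ^ 2 * fderiv ℝ (fun p : EuclideanSpace ℝ (Fin n) ×
    EuclideanSpace ℝ (Fin n) => F p.1 p.2) (x, y) (0, u) * h1
end Coordinates
end SphFinsler
end

/-! ### Radial functions and their regularity at the origin -/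

noncomputable section
namespace SphFinsler

open Filter Topology

section Radial

namespace IsRadiusInterval

variable {I : Set ℝ} (hI : IsRadiusInterval I)
include hI

theorem nonneg {r : ℝ} (hr : r ∈ I) : 0 ≤ r := by
  rcases hI with ⟨ν, h0, rfl⟩ | ⟨a, b, h0, h1, rfl⟩ | rfl | ⟨a, h0, rfl⟩
  · exact hr.1
  · exact h0.trans hr.1.le
  · exact hr
  · exact h0.trans (le_of_lt hr)

theorem mem_nhds {r : ℝ} (hr : r ∈ I) (h : 0 < r) : I ∈ 𝓝 r := by
  rcases hI with ⟨ν, h0, rfl⟩ | ⟨a, b, h0, h1, rfl⟩ | rfl | ⟨a, h0, rfl⟩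
  · exact Ico_mem_nhds h hr.2
  · exact Ioo_mem_nhds hr.1 hr.2
  · exact Ici_mem_nhds h
  · exact Ioi_mem_nhds hr

theorem mem_nhdsGE (hr : (0 : ℝ) ∈ I) : I ∈ 𝓝[≥] (0 : ℝ) := by
  rcases hI with ⟨ν, h0, rfl⟩ | ⟨a, b, h0, h1, rfl⟩ | rfl | ⟨a, h0, rfl⟩
  · exact Ico_mem_nhdsGE h0
  · exact absurd hr.1 (not_lt.2 h0)
  · exact self_mem_nhdsWithin
  · exact absurd hr (not_lt.2 h0)

theorem isOpen_symDomain (n : ℕ) : IsOpen (symDomain n I) := by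
  rw [isOpen_iff_mem_nhds]
  intro x hx
  rcases eq_or_ne x 0 with rfl | h0
  · have h1 : Tendsto (fun x : EuclideanSpace ℝ (Fin n) => ‖x‖) (𝓝 0) (𝓝[≥] 0) :=
      tendsto_nhdsWithin_iff.2 ⟨by simpa using (continuous_norm.tendsto
        (0 : EuclideanSpace ℝ (Fin n))), Eventually.of_forall fun x => norm_nonneg x⟩
    exact h1 (hI.mem_nhdsGE (by simpa [symDomain] using hx))
  · exact continuous_norm.continuousAt (hI.mem_nhds hx (norm_pos_iff.2 h0))

end IsRadiusInterval

variable {E : Type*} [NormedAddCommGroup E] [InnerProductSpace ℝ E]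

theorem hasFDerivAt_norm {x : E} (hx : x ≠ 0) :
    HasFDerivAt (fun x : E => ‖x‖) ((1 / ‖x‖) • innerSL ℝ x) x := by
  have h1 := (hasStrictFDerivAt_norm_sq x).hasFDerivAt.sqrt (by simpa using hx)
  have h2 : (fun x : E => √(‖x‖ ^ 2)) = fun x => ‖x‖ := by
    funext x
    exact Real.sqrt_sq (norm_nonneg x)
  rw [h2] at h1
  refine h1.congr_fderiv ?_
  rw [Real.sqrt_sq (norm_nonneg x)]
  ext v
  simp
  ring

theorem hasFDerivAt_comp_norm {k : ℝ → ℝ} {k' : ℝ} {x : E} (hx : x ≠ 0)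
    (hk : HasDerivAt k k' ‖x‖) :
    HasFDerivAt (fun x : E => k ‖x‖) ((k' / ‖x‖) • innerSL ℝ x) x := by
  refine (hk.comp_hasFDerivAt x (hasFDerivAt_norm hx)).congr_fderiv ?_
  rw [smul_smul]
  congr 1
  ring

/-- The profile of a differentiable radial function is differentiable away from the origin. -/
theorem differentiableAt_of_comp_norm {k : ℝ → ℝ} {x : E} (hx : x ≠ 0)
    (hk : DifferentiableAt ℝ (fun x : E => k ‖x‖) x) : DifferentiableAt ℝ k ‖x‖ := by
  have hr : 0 < ‖x‖ := norm_pos_iff.2 hx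
  have h1 : DifferentiableAt ℝ (fun t : ℝ => (t / ‖x‖) • x) ‖x‖ := by fun_prop
  have h2 : (‖x‖ / ‖x‖) • x = x := by rw [div_self hr.ne', one_smul]
  rw [← h2] at hk
  refine (hk.comp (f := fun t : ℝ => (t / ‖x‖) • x) ‖x‖ h1).congr_of_eventuallyEq ?_
  filter_upwards [Ioi_mem_nhds hr] with t ht
  simp only [Function.comp, norm_smul, norm_div, Real.norm_eq_abs, abs_norm]
  rw [div_mul_cancel₀ _ hr.ne', abs_of_pos ht]

/-- A differentiable radial function has a critical point at the origin. -/
theorem hasDerivWithinAt_of_comp_norm_zero [Nontrivial E] {k : ℝ → ℝ}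
    (hk : DifferentiableAt ℝ (fun x : E => k ‖x‖) 0) :
    HasDerivWithinAt k 0 (Set.Ici 0) 0 := by
  obtain ⟨e, he⟩ := exists_norm_eq E (zero_le_one (α := ℝ))
  set L := fderiv ℝ (fun x : E => k ‖x‖) 0 with hL
  have h1 : ∀ e : E, ‖e‖ = 1 → HasDerivWithinAt k (L e) (Set.Ici 0) 0 := by
    intro e he
    have a1 : HasDerivAt (fun t : ℝ => t • e) e 0 := by
      simpa using (hasDerivAt_id (0 : ℝ)).smul_const e
    have a2 : HasFDerivAt (fun x : E => k ‖x‖) L ((0 : ℝ) • e) := by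
      rw [zero_smul]; exact hk.hasFDerivAt
    have a3 : HasDerivAt (fun t : ℝ => k ‖t • e‖) (L e) 0 :=
      HasFDerivAt.comp_hasDerivAt (l := fun x : E => k ‖x‖) (f := fun t : ℝ => t • e) 0 a2 a1
    refine a3.hasDerivWithinAt.congr (fun t ht => ?_) (by simp)
    rw [norm_smul, he, mul_one, Real.norm_of_nonneg ht]
  have h2 := (uniqueDiffWithinAt_Ici (0 : ℝ)).eq_deriv _ (h1 e he) (h1 (-e) (by simpa using he))
  have h3 : L e = 0 := by
    rw [map_neg] at h2
    linarith
  have := h1 e he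
  rwa [h3] at this

theorem hasFDerivAt_comp_norm_zero {k : ℝ → ℝ} (hk : HasDerivWithinAt k 0 (Set.Ici 0) 0) :
    HasFDerivAt (fun x : E => k ‖x‖) (0 : E →L[ℝ] ℝ) 0 := by
  rw [hasDerivWithinAt_iff_isLittleO] at hk
  have h1 : Tendsto (fun x : E => ‖x‖) (𝓝 0) (𝓝[≥] 0) :=
    tendsto_nhdsWithin_iff.2 ⟨by simpa using (continuous_norm.tendsto (0 : E)),
      Eventually.of_forall fun x => norm_nonneg x⟩
  have h2 := hk.comp_tendsto h1
  refine HasFDerivAtFilter.of_isLittleO ?_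
  simp only [Function.comp_def, sub_zero, smul_zero] at h2
  simpa [Function.comp_def] using Asymptotics.isLittleO_norm_right.1 h2

variable {n : ℕ} {I : Set ℝ} (hI : IsRadiusInterval I)
include hI

/-- At the origin the asserted derivative is 0, because `innerSL ℝ 0 = 0`; the condition b 0 = 0
makes this correct, a one-sided derivative 0 of the profile giving a zero Fréchet derivative. -/
theorem hasFDerivAt_of_isAntiderivOn {b k : ℝ → ℝ} (hk : IsAntiderivOn I b k)
    (h0 : (0 : ℝ) ∈ I → b 0 = 0) {x : EuclideanSpace ℝ (Fin n)} (hx : x ∈ symDomain n I) :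
    HasFDerivAt (fun x : EuclideanSpace ℝ (Fin n) => k ‖x‖) ((b ‖x‖ / ‖x‖) • innerSL ℝ x) x := by
  rcases eq_or_ne x 0 with rfl | hx0
  · have hz : (0 : ℝ) ∈ I := by simpa [symDomain] using hx
    have h1 := hk 0 hz
    rw [h0 hz] at h1
    have h2 : HasDerivWithinAt k 0 (Set.Ici 0) 0 :=
      h1.mono_of_mem_nhdsWithin (hI.mem_nhdsGE hz)
    simpa using hasFDerivAt_comp_norm_zero h2
  · exact hasFDerivAt_comp_norm hx0
      ((hk _ hx).hasDerivAt (hI.mem_nhds hx (norm_pos_iff.2 hx0)))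

/-- Gives smoothness across the origin to functions known only as antiderivatives. -/
theorem contDiffOn_of_hasFDerivAt {K : EuclideanSpace ℝ (Fin n) → ℝ}
    {v : EuclideanSpace ℝ (Fin n) → EuclideanSpace ℝ (Fin n)}
    (hv : ContDiffOn ℝ ∞ v (symDomain n I))
    (hK : ∀ x ∈ symDomain n I, HasFDerivAt K (innerSL ℝ (v x)) x) :
    ContDiffOn ℝ ∞ K (symDomain n I) := by
  rw [contDiffOn_infty_iff_fderiv_of_isOpen (hI.isOpen_symDomain n)]
  refine ⟨fun x hx => (hK x hx).differentiableAt.differentiableWithinAt, ?_⟩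
  refine ((innerSL ℝ (E := EuclideanSpace ℝ (Fin n))).contDiff.comp_contDiffOn hv).congr ?_
  intro x hx
  exact (hK x hx).fderiv

theorem isAntiderivOn_derivWithin (hn : 2 ≤ n) {k : ℝ → ℝ}
    (hk : ContDiffOn ℝ ∞ (fun x : EuclideanSpace ℝ (Fin n) => k ‖x‖) (symDomain n I)) :
    IsAntiderivOn I (derivWithin k I) k ∧ ((0 : ℝ) ∈ I → derivWithin k I 0 = 0) := by
  have : Nonempty (Fin n) := ⟨⟨0, by omega⟩⟩
  have hd : ∀ x ∈ symDomain n I,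
      DifferentiableAt ℝ (fun x : EuclideanSpace ℝ (Fin n) => k ‖x‖) x := fun x hx =>
    (hk.contDiffAt ((hI.isOpen_symDomain n).mem_nhds hx)).differentiableAt (by simp)
  have h0 : (0 : ℝ) ∈ I → HasDerivWithinAt k 0 I 0 := fun hz =>
    (hasDerivWithinAt_of_comp_norm_zero (hd 0 (by simpa [symDomain] using hz))).mono
      fun r hr => hI.nonneg hr
  refine ⟨fun r hr => ?_, fun hz => ?_⟩
  · rcases (hI.nonneg hr).eq_or_lt with rfl | hpos
    · exact (h0 hr).differentiableWithinAt.hasDerivWithinAt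
    · obtain ⟨x, hx⟩ := exists_norm_eq (EuclideanSpace ℝ (Fin n)) hpos.le
      have hx0 : x ≠ 0 := norm_pos_iff.1 (hx ▸ hpos)
      have := differentiableAt_of_comp_norm hx0 (hd x (by simpa [symDomain, hx] using hr))
      rw [hx] at this
      exact this.differentiableWithinAt.hasDerivWithinAt
  · refine (h0 hz).derivWithin ?_
    exact (uniqueDiffWithinAt_Ici (0 : ℝ)).mono_nhds
      (nhdsWithin_le_iff.2 (hI.mem_nhdsGE hz))

theorem hasFDerivAt_radial (hn : 2 ≤ n) {k : ℝ → ℝ}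
    (hk : ContDiffOn ℝ ∞ (fun x : EuclideanSpace ℝ (Fin n) => k ‖x‖) (symDomain n I))
    {x : EuclideanSpace ℝ (Fin n)} (hx : x ∈ symDomain n I) :
    HasFDerivAt (fun x : EuclideanSpace ℝ (Fin n) => k ‖x‖)
      ((derivWithin k I ‖x‖ / ‖x‖) • innerSL ℝ x) x :=
  hasFDerivAt_of_isAntiderivOn hI (isAntiderivOn_derivWithin hI hn hk).1
    (isAntiderivOn_derivWithin hI hn hk).2 hx

/-- The gradient of a smooth radial function is smooth. -/
theorem contDiffOn_radial_gradient (hn : 2 ≤ n) {k : ℝ → ℝ}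
    (hk : ContDiffOn ℝ ∞ (fun x : EuclideanSpace ℝ (Fin n) => k ‖x‖) (symDomain n I)) :
    ContDiffOn ℝ ∞ (fun x : EuclideanSpace ℝ (Fin n) => (derivWithin k I ‖x‖ / ‖x‖) • x)
      (symDomain n I) := by
  have h1 := ((contDiffOn_infty_iff_fderiv_of_isOpen (hI.isOpen_symDomain n)).1 hk).2
  have h2 := (InnerProductSpace.toDual ℝ
    (EuclideanSpace ℝ (Fin n))).symm.contDiff.comp_contDiffOn h1
  refine h2.congr fun x hx => ?_
  rw [Function.comp, (hasFDerivAt_radial hI hn hk hx).fderiv]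
  symm
  rw [LinearIsometryEquiv.symm_apply_eq]
  ext v
  simp

end Radial

/-- The coefficient `f` of `s²` in `Q = g + f s²`. -/
def quadCoeff (I : Set ℝ) (g : ℝ → ℝ) (r : ℝ) : ℝ :=
  (derivWithin g I r / r + 2 * g r ^ 2) / (1 - 2 * r ^ 2 * g r)

/-! ### The differential equations that tie T, Tbar and f to g -/

section TPair

variable {n : ℕ} {I : Set ℝ} {g T Tbar : ℝ → ℝ} (hI : IsRadiusInterval I) (hn : 2 ≤ n)
  (hg : ContDiffOn ℝ ∞ (fun x : EuclideanSpace ℝ (Fin n) => g ‖x‖) (symDomain n I))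
  (hT : IsTPair I g T Tbar)

include hT in
theorem IsTPair.pos {r : ℝ} (hr : r ∈ I) : 0 < T r := by
  obtain ⟨h1, ⟨J, -, h2⟩, -⟩ := hT
  have := h1 r hr
  rw [h2 r hr, Tfun]
  positivity

include hI hn hg hT

/-- The quotient g'(r)/r is 0 by convention at r = 0, so f itself may jump there. The field f x is
smooth because g'(r)x/r is the gradient of g; only f x is needed at the origin. -/
theorem contDiffOn_quadCoeff_smul :
    ContDiffOn ℝ ∞ (fun x : EuclideanSpace ℝ (Fin n) => quadCoeff I g ‖x‖ • x)
      (symDomain n I) := by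
  have h1 := contDiffOn_radial_gradient hI hn hg
  have h2 : ContDiffOn ℝ ∞ (fun x : EuclideanSpace ℝ (Fin n) => 1 - 2 * ‖x‖ ^ 2 * g ‖x‖)
      (symDomain n I) :=
    contDiffOn_const.sub ((contDiffOn_const.mul (contDiff_norm_sq ℝ).contDiffOn).mul hg)
  have h3 := (h2.inv fun x hx => hT.1 _ hx).smul
    (h1.add ((contDiffOn_const (c := (2 : ℝ)).mul (hg.pow 2)).smul contDiffOn_id))
  refine h3.congr fun x hx => ?_
  change quadCoeff I g ‖x‖ • x = (1 - 2 * ‖x‖ ^ 2 * g ‖x‖)⁻¹ •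
    ((derivWithin g I ‖x‖ / ‖x‖) • x + (2 * g ‖x‖ ^ 2) • x)
  rw [← add_smul, smul_smul]
  congr 1
  rw [quadCoeff]
  ring

/-- Logarithmic differentiation gives T'/T = 4r(g + rg')/(1 − 2r²g), which equals 4r(g + r²f). -/
theorem IsTPair.contDiffOn_fst_and_hasFDerivAt :
    ContDiffOn ℝ ∞ (fun x : EuclideanSpace ℝ (Fin n) => T ‖x‖) (symDomain n I) ∧
    ∀ x ∈ symDomain n I, HasFDerivAt (fun x : EuclideanSpace ℝ (Fin n) => T ‖x‖)
      ((4 * T ‖x‖ * (g ‖x‖ + ‖x‖ ^ 2 * quadCoeff I g ‖x‖)) • innerSL ℝ x) x := by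
  obtain ⟨h1, ⟨J, hJ, h2⟩, -⟩ := hT
  have hM := hI.isOpen_symDomain n
  have dJ : ∀ x ∈ symDomain n I, HasFDerivAt (fun x : EuclideanSpace ℝ (Fin n) => J ‖x‖)
      (innerSL ℝ ((4 * g ‖x‖ / (1 - 2 * ‖x‖ ^ 2 * g ‖x‖)) • x)) x := by
    intro x hx
    refine (hasFDerivAt_of_isAntiderivOn hI hJ (fun _ => by simp) hx).congr_fderiv ?_
    rw [map_smul]
    rcases eq_or_ne x 0 with rfl | hx0
    · simp
    · congr 1
      have := norm_ne_zero_iff.2 hx0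
      field_simp
  have s2 : ContDiffOn ℝ ∞ (fun x : EuclideanSpace ℝ (Fin n) => 1 - 2 * ‖x‖ ^ 2 * g ‖x‖)
      (symDomain n I) :=
    contDiffOn_const.sub ((contDiffOn_const.mul (contDiff_norm_sq ℝ).contDiffOn).mul hg)
  have sJ : ContDiffOn ℝ ∞ (fun x : EuclideanSpace ℝ (Fin n) => J ‖x‖) (symDomain n I) :=
    contDiffOn_of_hasFDerivAt hI
      (((contDiffOn_const.mul hg).div s2 fun x hx => h1 _ hx).smul contDiffOn_id) dJ
  refine ⟨?_, fun x hx => ?_⟩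
  · refine (sJ.neg.exp.div (s2.pow 2) fun x hx => pow_ne_zero 2 (h1 _ hx)).congr
      fun x hx => h2 _ hx
  · have dg := hasFDerivAt_radial hI hn hg hx
    have dN := (hasStrictFDerivAt_norm_sq x).hasFDerivAt
    have d2 := ((dN.const_mul 2).mul dg).const_sub 1
    have hne := h1 _ hx
    have d3 := (dJ x hx).neg.exp.mul ((hasDerivAt_inv (pow_ne_zero 2 hne)).comp_hasFDerivAt x
      (d2.pow 2))
    have heq : (fun x : EuclideanSpace ℝ (Fin n) => T ‖x‖) =ᶠ[𝓝 x]
        fun x => Real.exp (-J ‖x‖) * ((1 - 2 * ‖x‖ ^ 2 * g ‖x‖) ^ 2)⁻¹ := by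
      filter_upwards [hM.mem_nhds hx] with z hz
      rw [h2 _ hz, Tfun, div_eq_mul_inv]
    refine (d3.congr_of_eventuallyEq heq).congr_fderiv ?_
    rw [h2 _ hx, Tfun, quadCoeff]
    ext v
    simp
    set γ := derivWithin g I ‖x‖ / ‖x‖
    field_simp
    ring

theorem IsTPair.contDiffOn_snd_and_hasFDerivAt :
    ContDiffOn ℝ ∞ (fun x : EuclideanSpace ℝ (Fin n) => Tbar ‖x‖) (symDomain n I) ∧
    ∀ x ∈ symDomain n I, HasFDerivAt (fun x : EuclideanSpace ℝ (Fin n) => Tbar ‖x‖)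
      ((4 * T ‖x‖ * quadCoeff I g ‖x‖) • innerSL ℝ x) x := by
  have hd : ∀ x ∈ symDomain n I, HasFDerivAt (fun x : EuclideanSpace ℝ (Fin n) => Tbar ‖x‖)
      ((4 * T ‖x‖ * quadCoeff I g ‖x‖) • innerSL ℝ x) x := by
    intro x hx
    have h0 := (isAntiderivOn_derivWithin hI hn hg).2
    refine (hasFDerivAt_of_isAntiderivOn hI hT.2.2 (fun hz => by simp [h0 hz]) hx).congr_fderiv ?_
    rcases eq_or_ne x 0 with rfl | hx0
    · simp
    · congr 1
      have := norm_ne_zero_iff.2 hx0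
      have := hT.1 _ hx
      rw [quadCoeff]
      field_simp
  refine ⟨contDiffOn_of_hasFDerivAt hI (v := fun x => (4 * T ‖x‖) • (quadCoeff I g ‖x‖ • x))
    ((contDiffOn_const.mul (hT.contDiffOn_fst_and_hasFDerivAt hI hn hg).1).smul
      (contDiffOn_quadCoeff_smul hI hn hg hT)) fun x hx => ?_, hd⟩
  rw [smul_smul, map_smul]
  exact hd x hx

/-- Away from the origin f is recovered as ⟨f x, x⟩/|x|². -/
theorem exists_hasFDerivAt_quadCoeff {x : EuclideanSpace ℝ (Fin n)} (hx : x ∈ symDomain n I)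
    (hx0 : x ≠ 0) : ∃ c : ℝ, HasFDerivAt
      (fun x : EuclideanSpace ℝ (Fin n) => quadCoeff I g ‖x‖) (c • innerSL ℝ x) x := by
  have hM := hI.isOpen_symDomain n
  have h1 : DifferentiableAt ℝ
      (fun x : EuclideanSpace ℝ (Fin n) => quadCoeff I g ‖x‖ • x) x :=
    ((contDiffOn_quadCoeff_smul hI hn hg hT).contDiffAt (hM.mem_nhds hx)).differentiableAt
      (by simp)
  have h2 : DifferentiableAt ℝ (fun x : EuclideanSpace ℝ (Fin n) =>
      inner ℝ (quadCoeff I g ‖x‖ • x) x / ‖x‖ ^ 2) x := by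
    have h3 : DifferentiableAt ℝ (fun x : EuclideanSpace ℝ (Fin n) => ‖x‖ ^ 2) x :=
      (contDiff_norm_sq ℝ (n := 1)).differentiable (by simp) x
    have h4 : DifferentiableAt ℝ (fun x : EuclideanSpace ℝ (Fin n) =>
        (inner ℝ (quadCoeff I g ‖x‖ • x) x : ℝ)) x := h1.inner ℝ differentiableAt_id
    simp only [div_eq_mul_inv]
    exact h4.fun_mul (h3.fun_inv (pow_ne_zero 2 (norm_ne_zero_iff.2 hx0)))
  have h3 : DifferentiableAt ℝ (fun x : EuclideanSpace ℝ (Fin n) => quadCoeff I g ‖x‖) x := by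
    refine h2.congr_of_eventuallyEq ?_
    filter_upwards [isOpen_ne.mem_nhds hx0] with z hz
    have : ‖z‖ ≠ 0 := norm_ne_zero_iff.2 hz
    rw [inner_smul_left, real_inner_self_eq_norm_sq]
    simp
    field_simp
  exact ⟨_, hasFDerivAt_comp_norm hx0 (differentiableAt_of_comp_norm hx0 h3).hasDerivAt⟩

end TPair
end SphFinsler
end

/-! ### Scalar calculus of the profile -/

noncomputable section
namespace SphFinsler

open Filter Topology

section Profile

/-- The Finsler function in terms of `T`, `Tbar`, `h`, `R = |x|²`, `S = ⟨x, y⟩` and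
`a = √((T - R Tbar) |y|² + Tbar S²)`. -/
def profile (ε T B h R S a : ℝ) : ℝ :=
  ε * a / (T - R * B) +
    (R ^ 2 * a + 2 * R * T * S ^ 2 / a - T ^ 2 * S ^ 4 / (3 * a ^ 3)) / (T - R * B) ^ 3 + S * h

/-- The partial derivative of `profile` in `a`. -/
def profileA (ε T B R S a : ℝ) : ℝ :=
  ε / (T - R * B) + (R - T * (S / a) ^ 2) ^ 2 / (T - R * B) ^ 3

/-- The coefficient of `x` in the fibre gradient of the Finsler function. -/
def profileV (ε T B h R S a : ℝ) : ℝ :=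
  h + (4 * R * T * (S / a) - 4 / 3 * T ^ 2 * (S / a) ^ 3) / (T - R * B) ^ 3 +
    profileA ε T B R S a * (B * (S / a))

/-- The coefficient of `y` in the fibre gradient of the Finsler function, where
`W = R |y|² - S²`. -/
def profileU (ε W a : ℝ) : ℝ := (ε + (W / a ^ 2) ^ 2) / a

/-- The coefficient of `x` in the gradient in `x` of the Finsler function. -/
def profileX (ε T B h' R N S a g f : ℝ) : ℝ :=
  (-(ε * a) / (T - R * B) ^ 2 + (2 * R * S ^ 2 / a - 2 * T * S ^ 4 / (3 * a ^ 3)) / (T - R * B) ^ 3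
    - 3 * (R ^ 2 * a + 2 * R * T * S ^ 2 / a - T ^ 2 * S ^ 4 / (3 * a ^ 3)) / (T - R * B) ^ 4)
      * (4 * T * (g + R * f)) +
  (ε * a * R / (T - R * B) ^ 2 + 3 * R *
    (R ^ 2 * a + 2 * R * T * S ^ 2 / a - T ^ 2 * S ^ 4 / (3 * a ^ 3)) / (T - R * B) ^ 4)
      * (4 * T * f) +
  (ε * a * B / (T - R * B) ^ 2 + (2 * R * a + 2 * T * S ^ 2 / a) / (T - R * B) ^ 3 + 3 * B *
    (R ^ 2 * a + 2 * R * T * S ^ 2 / a - T ^ 2 * S ^ 4 / (3 * a ^ 3)) / (T - R * B) ^ 4) * 2 +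
  S * h' + profileA ε T B R S a * (((4 * T * g - 2 * B) * N + 4 * T * f * S ^ 2) / (2 * a))

variable {ε : ℝ} {T B h R S a W : ℝ → ℝ} {T' B' h' R' S' a' W' t : ℝ}

theorem hasDerivAt_profile (hT : HasDerivAt T T' t) (hB : HasDerivAt B B' t)
    (hh : HasDerivAt h h' t) (hR : HasDerivAt R R' t) (hS : HasDerivAt S S' t)
    (ha : HasDerivAt a a' t) (h0 : a t ≠ 0) (hA : T t - R t * B t ≠ 0) :
    HasDerivAt (fun t => profile ε (T t) (B t) (h t) (R t) (S t) (a t))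
      ((-(ε * a t) / (T t - R t * B t) ^ 2 +
        (2 * R t * S t ^ 2 / a t - 2 * T t * S t ^ 4 / (3 * a t ^ 3)) / (T t - R t * B t) ^ 3
        - 3 * (R t ^ 2 * a t + 2 * R t * T t * S t ^ 2 / a t - T t ^ 2 * S t ^ 4 / (3 * a t ^ 3)) /
          (T t - R t * B t) ^ 4) * T' +
      (ε * a t * R t / (T t - R t * B t) ^ 2 + 3 * R t *
        (R t ^ 2 * a t + 2 * R t * T t * S t ^ 2 / a t - T t ^ 2 * S t ^ 4 / (3 * a t ^ 3)) /
          (T t - R t * B t) ^ 4) * B' +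
      (ε * a t * B t / (T t - R t * B t) ^ 2 +
        (2 * R t * a t + 2 * T t * S t ^ 2 / a t) / (T t - R t * B t) ^ 3 + 3 * B t *
        (R t ^ 2 * a t + 2 * R t * T t * S t ^ 2 / a t - T t ^ 2 * S t ^ 4 / (3 * a t ^ 3)) /
          (T t - R t * B t) ^ 4) * R' + S t * h' +
      (h t + (4 * R t * T t * (S t / a t) - 4 / 3 * T t ^ 2 * (S t / a t) ^ 3) /
        (T t - R t * B t) ^ 3) * S' + profileA ε (T t) (B t) (R t) (S t) (a t) * a') t := by
  have hA' := hT.fun_sub (hR.fun_mul hB)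
  have h1 := (ha.const_mul ε).fun_div hA' hA
  have h2 := ((hR.fun_pow 2).fun_mul ha).fun_add
    ((((hR.const_mul 2).fun_mul hT).fun_mul (hS.fun_pow 2)).fun_div ha h0)
  have h3 := ((hT.fun_pow 2).fun_mul (hS.fun_pow 4)).fun_div ((ha.fun_pow 3).const_mul 3)
    (mul_ne_zero three_ne_zero (pow_ne_zero 3 h0))
  have h4 := (h1.fun_add ((h2.fun_sub h3).fun_div (hA'.fun_pow 3) (pow_ne_zero 3 hA))).fun_add
    (hS.fun_mul hh)
  refine h4.congr_deriv ?_
  unfold profileA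
  generalize T t = T, B t = B, R t = R, S t = S, a t = a, h t = h at *
  -- With A = T − RB as the independent variable all denominators are monomials.
  obtain ⟨A, rfl⟩ : ∃ A, T = A + R * B := ⟨T - R * B, by ring⟩
  simp only [add_sub_cancel_right] at *
  field_simp
  ring

theorem hasDerivAt_profileV (hT : HasDerivAt T T' t) (hB : HasDerivAt B B' t)
    (hh : HasDerivAt h h' t) (hR : HasDerivAt R R' t) (hS : HasDerivAt S S' t)
    (ha : HasDerivAt a a' t) (h0 : a t ≠ 0) (hA : T t - R t * B t ≠ 0) :
    HasDerivAt (fun t => profileV ε (T t) (B t) (h t) (R t) (S t) (a t))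
      ((4 * R t * (S t / a t) - 8 / 3 * T t * (S t / a t) ^ 3) / (T t - R t * B t) ^ 3 * T' +
      4 * T t * (S t / a t) / (T t - R t * B t) ^ 3 * R' -
      3 * (4 * R t * T t * (S t / a t) - 4 / 3 * T t ^ 2 * (S t / a t) ^ 3) /
        (T t - R t * B t) ^ 4 * (T' - R' * B t - R t * B') +
      h' + (2 * (R t - T t * (S t / a t) ^ 2) * (R' - T' * (S t / a t) ^ 2) /
        (T t - R t * B t) ^ 3 - (ε / (T t - R t * B t) ^ 2 +
          3 * (R t - T t * (S t / a t) ^ 2) ^ 2 / (T t - R t * B t) ^ 4) *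
            (T' - R' * B t - R t * B')) * (B t * (S t / a t)) +
      profileA ε (T t) (B t) (R t) (S t) (a t) * (B' * (S t / a t)) +
      (ε * B t + 4 * ((R t - T t * (S t / a t) ^ 2) / (T t - R t * B t)) +
        5 * B t * ((R t - T t * (S t / a t) ^ 2) / (T t - R t * B t)) ^ 2) / (T t - R t * B t) *
        ((S' * a t - S t * a') / a t ^ 2)) t := by
  have hA' := hT.fun_sub (hR.fun_mul hB)
  have hσ := hS.fun_div ha h0
  have h1 := hR.fun_sub (hT.fun_mul (hσ.fun_pow 2))
  have h2 := ((hasDerivAt_const t ε).fun_div hA' hA).fun_add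
    ((h1.fun_pow 2).fun_div (hA'.fun_pow 3) (pow_ne_zero 3 hA))
  have h3 := (((hR.const_mul 4).fun_mul hT).fun_mul hσ).fun_sub
    (((hT.fun_pow 2).const_mul (4 / 3)).fun_mul (hσ.fun_pow 3))
  have h4 := (hh.fun_add (h3.fun_div (hA'.fun_pow 3) (pow_ne_zero 3 hA))).fun_add
    (h2.fun_mul (hB.fun_mul hσ))
  refine h4.congr_deriv ?_
  unfold profileA
  generalize (S' * a t - S t * a') / a t ^ 2 = σ'
  generalize S t / a t = σ
  generalize T t = T, B t = B, R t = R, S t = S, a t = a, h t = h at *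
  obtain ⟨A, rfl⟩ : ∃ A, T = A + R * B := ⟨T - R * B, by ring⟩
  simp only [add_sub_cancel_right] at *
  field_simp
  ring

theorem hasDerivAt_profileU (hW : HasDerivAt W W' t) (ha : HasDerivAt a a' t) (h0 : a t ≠ 0) :
    HasDerivAt (fun t => profileU ε (W t) (a t))
      (-(ε * a') / a t ^ 2 + 2 * W t * W' / a t ^ 5 - 5 * W t ^ 2 * a' / a t ^ 6) t := by
  have h1 := (((hasDerivAt_const t ε)).fun_add
    ((hW.fun_div (ha.fun_pow 2) (pow_ne_zero 2 h0)).fun_pow 2)).fun_div ha h0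
  refine h1.congr_deriv ?_
  generalize W t = W, a t = a at *
  simp only [Nat.reduceSub, pow_one, Nat.cast_ofNat, zero_add]
  field_simp
  ring

section Identities

variable {ε T B h h' R N S a g f c s m : ℝ}

/-- The identity Ra² − TS² = AW identifies the square in `profileA` with (W/a²)², up to powers of A.
-/
theorem profileU_eq (ha : a ≠ 0) (hA : T - R * B ≠ 0) (h2 : a ^ 2 = (T - R * B) * N + B * S ^ 2) :
    profileU ε (R * N - S ^ 2) a = profileA ε T B R S a * ((T - R * B) / a) := by
  have h1 : (R * N - S ^ 2) / a ^ 2 = (R - T * (S / a) ^ 2) / (T - R * B) := by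
    field_simp
    linear_combination (-R) * h2
  rw [profileU, h1, profileA]
  field_simp

/-- Euler's relation F = F_y(y) for F_y = U y + V x, in scalar form; it rests on NA/a = a − BS²/a.
-/
theorem profile_eq (ha : a ≠ 0) (hA : T - R * B ≠ 0)
    (h2 : a ^ 2 = (T - R * B) * N + B * S ^ 2) :
    profile ε T B h R S a =
      N * profileU ε (R * N - S ^ 2) a + S * profileV ε T B h R S a := by
  rw [profileU_eq ha hA h2, profileV]
  have h3 : N * (profileA ε T B R S a * ((T - R * B) / a)) = profileA ε T B R S a *
      (a - B * S ^ 2 / a) := by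
    have : N * ((T - R * B) / a) = a - B * S ^ 2 / a := by
      field_simp
      linear_combination -h2
    rw [← this]
    ring
  rw [h3, profile, profileA]
  field_simp
  ring

/-- The Euler-Lagrange equation for the coefficient of `x`. -/
theorem profileV_along_spray (ha : a ≠ 0) (hA : T - R * B ≠ 0)
    (h2 : a ^ 2 = (T - R * B) * N + B * S ^ 2) :
    (4 * R * (S / a) - 8 / 3 * T * (S / a) ^ 3) / (T - R * B) ^ 3 *
        (4 * T * (g + R * f) * S) +
      4 * T * (S / a) / (T - R * B) ^ 3 * (2 * S) -
      3 * (4 * R * T * (S / a) - 4 / 3 * T ^ 2 * (S / a) ^ 3) /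
        (T - R * B) ^ 4 * (4 * T * (g + R * f) * S - 2 * S * B - R * (4 * T * f * S)) +
      h' * S + (2 * (R - T * (S / a) ^ 2) * (2 * S - 4 * T * (g + R * f) * S * (S / a) ^ 2) /
        (T - R * B) ^ 3 - (ε / (T - R * B) ^ 2 +
          3 * (R - T * (S / a) ^ 2) ^ 2 / (T - R * B) ^ 4) *
            (4 * T * (g + R * f) * S - 2 * S * B - R * (4 * T * f * S))) * (B * (S / a)) +
      profileA ε T B R S a * (4 * T * f * S * (S / a)) +
      (ε * B + 4 * ((R - T * (S / a) ^ 2) / (T - R * B)) +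
        5 * B * ((R - T * (S / a) ^ 2) / (T - R * B)) ^ 2) / (T - R * B) *
        (((N - 2 * (g * N + f * S ^ 2) * R) * a - S * 0) / a ^ 2) =
    profileX ε T B h' R N S a g f +
      2 * (g * N + f * S ^ 2) * profileU ε (R * N - S ^ 2) a := by
  -- The left side is the derivative in `hasDerivAt_profileV` along (y, −2qx): T' = 4T(g + Rf)S, B'
  -- = 4TfS, R' = 2S, S' = N − 2qR and a' = 0.
  rw [profileU_eq ha hA h2]
  unfold profileX profileA
  obtain ⟨A, rfl⟩ : ∃ A, T = A + R * B := ⟨T - R * B, by ring⟩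
  simp only [add_sub_cancel_right] at *
  obtain rfl : N = (a ^ 2 - B * S ^ 2) / A := by
    rw [h2]; field_simp; ring
  field_simp
  ring

/-- The fibre Hessian of the Finsler function. -/
theorem profile_hessian (ha : a ≠ 0) (hA : T - R * B ≠ 0) (hN : N ≠ 0)
    (h2 : a ^ 2 = (T - R * B) * N + B * S ^ 2) :
    (-(ε * (((T - R * B) * c + B * S * s) / a)) / a ^ 2 +
        2 * (R * N - S ^ 2) * (2 * R * c - 2 * S * s) / a ^ 5 -
        5 * (R * N - S ^ 2) ^ 2 * (((T - R * B) * c + B * S * s) / a) / a ^ 6) * c +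
      profileU ε (R * N - S ^ 2) a * m +
      (ε * B + 4 * ((R - T * (S / a) ^ 2) / (T - R * B)) +
        5 * B * ((R - T * (S / a) ^ 2) / (T - R * B)) ^ 2) / (T - R * B) *
        ((s * a - S * (((T - R * B) * c + B * S * s) / a)) / a ^ 2) * s =
    (profileU ε (R * N - S ^ 2) a * (m * N - c ^ 2) +
      (ε * B + 4 * ((R * N - S ^ 2) / a ^ 2) + 5 * B * ((R * N - S ^ 2) / a ^ 2) ^ 2) / a ^ 3 *
        (N * s - S * c) ^ 2) / N := by
  -- For a vertical direction u, the letters are m = |u|², c = ⟨y, u⟩, s = ⟨x, u⟩, with a' = (Ac +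
  -- BSs)/a and W' = 2Rc − 2Ss.
  have h1 : (R - T * (S / a) ^ 2) / (T - R * B) = (R * N - S ^ 2) / a ^ 2 := by
    field_simp
    linear_combination R * h2
  have h3 : (s * a - S * (((T - R * B) * c + B * S * s) / a)) / a ^ 2 =
      (T - R * B) * (N * s - S * c) / a ^ 3 := by
    field_simp
    linear_combination s * h2
  have h4 : ∀ K : ℝ, K / (T - R * B) * ((T - R * B) * (N * s - S * c) / a ^ 3) =
      K * (N * s - S * c) / a ^ 3 := fun K => by field_simp
  rw [h1, h3, h4, profileU]
  clear h1 h3 h4 hA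
  generalize T - R * B = A at *
  obtain rfl : A = (a ^ 2 - B * S ^ 2) / N := by
    rw [h2]; field_simp; ring
  clear h2
  field_simp
  ring

end Identities
end Profile
end SphFinsler
end

/-! ### The Finsler function on an inner product space and its first derivatives -/

noncomputable section
namespace SphFinsler

open Filter Topology

section Geometry

variable {E : Type*} [NormedAddCommGroup E] [InnerProductSpace ℝ E]

/-- Radial coefficient functions `T, Tbar, h, g, f` on an open set that satisfy the differential
equations relating `T`, `Tbar` and `f` to `g`; gradients are multiples of the position vector. -/
structure RadialData (M : Set E) (T B h g f : E → ℝ) : Prop where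
  isOpen : IsOpen M
  smooth_T : ContDiffOn ℝ ∞ T M
  smooth_B : ContDiffOn ℝ ∞ B M
  smooth_h : ContDiffOn ℝ ∞ h M
  smooth_g : ContDiffOn ℝ ∞ g M
  smooth_f : ContDiffOn ℝ ∞ (fun x => f x • x) M
  deriv_T : ∀ x ∈ M, HasFDerivAt T ((4 * T x * (g x + ‖x‖ ^ 2 * f x)) • innerSL ℝ x) x
  deriv_B : ∀ x ∈ M, HasFDerivAt B ((4 * T x * f x) • innerSL ℝ x) x
  deriv_h : ∀ x ∈ M, ∃ c : ℝ, HasFDerivAt h (c • innerSL ℝ x) x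
  deriv_g : ∀ x ∈ M, HasFDerivAt g
    ((f x * (1 - 2 * ‖x‖ ^ 2 * g x) - 2 * g x ^ 2) • innerSL ℝ x) x
  deriv_f : ∀ x ∈ M, x ≠ 0 → ∃ c : ℝ, HasFDerivAt f (c • innerSL ℝ x) x
  pos_T : ∀ x ∈ M, 0 < T x
  pos_A : ∀ x ∈ M, 0 < T x - ‖x‖ ^ 2 * B x

/-- The Riemannian quadratic form `(T - |x|² Tbar) |y|² + Tbar ⟨x, y⟩²`. -/
def quadForm (T B : E → ℝ) (p : E × E) : ℝ :=
  (T p.1 - ‖p.1‖ ^ 2 * B p.1) * ‖p.2‖ ^ 2 + B p.1 * inner ℝ p.1 p.2 ^ 2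

/-- The norm of the Riemannian quadratic form. -/
def rootForm (T B : E → ℝ) (p : E × E) : ℝ := √(quadForm T B p)

/-- The Finsler function with the given coefficient functions. -/
def finslerFun (ε : ℝ) (T B h : E → ℝ) (p : E × E) : ℝ :=
  profile ε (T p.1) (B p.1) (h p.1) (‖p.1‖ ^ 2) (inner ℝ p.1 p.2) (rootForm T B p)

/-- The coefficient of `y` in the fibre gradient of `finslerFun`. -/
def coeffU (ε : ℝ) (T B : E → ℝ) (p : E × E) : ℝ :=
  profileU ε (‖p.1‖ ^ 2 * ‖p.2‖ ^ 2 - inner ℝ p.1 p.2 ^ 2) (rootForm T B p)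

/-- The coefficient of `x` in the fibre gradient of `finslerFun`. -/
def coeffV (ε : ℝ) (T B h : E → ℝ) (p : E × E) : ℝ :=
  profileV ε (T p.1) (B p.1) (h p.1) (‖p.1‖ ^ 2) (inner ℝ p.1 p.2) (rootForm T B p)

/-- The quadratic factor `g |y|² + f ⟨x, y⟩²` of the spray. -/
def quadFactor (g f : E → ℝ) (p : E × E) : ℝ :=
  g p.1 * ‖p.2‖ ^ 2 + inner ℝ p.1 p.2 * inner ℝ (f p.1 • p.1) p.2

theorem quadFactor_eq (g f : E → ℝ) (p : E × E) :
    quadFactor g f p = g p.1 * ‖p.2‖ ^ 2 + f p.1 * inner ℝ p.1 p.2 ^ 2 := by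
  simp only [quadFactor, inner_smul_left]
  simp
  ring

theorem hasDerivAt_line {V W : Type*} [NormedAddCommGroup V] [NormedSpace ℝ V]
    [NormedAddCommGroup W] [NormedSpace ℝ W] {k : V → W} {k' : V →L[ℝ] W} {p : V}
    (hk : HasFDerivAt k k' p) (w : V) : HasDerivAt (fun t : ℝ => k (p + t • w)) (k' w) 0 := by
  have := hk.hasLineDerivAt w
  exact this

theorem fderiv_eq_of_line {V W : Type*} [NormedAddCommGroup V] [NormedSpace ℝ V]
    [NormedAddCommGroup W] [NormedSpace ℝ W] {k : V → W} {d : W} {p w : V}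
    (hk : DifferentiableAt ℝ k p) (h : HasDerivAt (fun t : ℝ => k (p + t • w)) d 0) :
    fderiv ℝ k p w = d :=
  (hasDerivAt_line hk.hasFDerivAt w).unique h

theorem hasDerivAt_line_fst {k : E → ℝ} {c : ℝ} {x : E} (hk : HasFDerivAt k (c • innerSL ℝ x) x)
    (y : E) (w : E × E) :
    HasDerivAt (fun t : ℝ => k ((x, y) + t • w).1) (c * inner ℝ x w.1) 0 := by
  simpa using hasDerivAt_line hk w.1

theorem hasDerivAt_line_norm_fst (p w : E × E) :
    HasDerivAt (fun t : ℝ => ‖(p + t • w).1‖ ^ 2) (2 * inner ℝ p.1 w.1) 0 := by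
  simpa using hasDerivAt_line (hasStrictFDerivAt_norm_sq p.1).hasFDerivAt w.1

theorem hasDerivAt_line_norm_snd (p w : E × E) :
    HasDerivAt (fun t : ℝ => ‖(p + t • w).2‖ ^ 2) (2 * inner ℝ p.2 w.2) 0 := by
  simpa using hasDerivAt_line (hasStrictFDerivAt_norm_sq p.2).hasFDerivAt w.2

theorem hasDerivAt_line_inner (p w : E × E) :
    HasDerivAt (fun t : ℝ => (inner ℝ (p + t • w).1 (p + t • w).2 : ℝ))
      (inner ℝ p.1 w.2 + inner ℝ w.1 p.2) 0 := by
  have h1 : HasFDerivAt (fun p : E × E => (inner ℝ p.1 p.2 : ℝ)) _ p :=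
    hasFDerivAt_fst.inner ℝ hasFDerivAt_snd
  simpa using hasDerivAt_line h1 w

theorem inner_sq_le (p : E × E) : inner ℝ p.1 p.2 ^ 2 ≤ ‖p.1‖ ^ 2 * ‖p.2‖ ^ 2 := by
  have := abs_real_inner_le_norm p.1 p.2
  rw [← mul_pow, ← sq_abs]
  gcongr

namespace RadialData

variable {M : Set E} {T B h g f : E → ℝ} (D : RadialData M T B h g f)
include D

theorem quadForm_pos {p : E × E} (hp : p ∈ slit M) : 0 < quadForm T B p := by
  have hN : 0 < ‖p.2‖ ^ 2 := by
    have := norm_pos_iff.2 hp.2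
    positivity
  have hA := D.pos_A _ hp.1
  have hT := D.pos_T _ hp.1
  have hW := inner_sq_le p
  rw [quadForm]
  -- The form is AN + BS² and also TN − BW with W ≥ 0; each sign of B makes one expression visibly
  -- positive.
  rcases le_total 0 (B p.1) with hB | hB
  · positivity
  · have h1 : 0 < T p.1 * ‖p.2‖ ^ 2 := by positivity
    nlinarith

theorem rootForm_pos {p : E × E} (hp : p ∈ slit M) : 0 < rootForm T B p :=
  Real.sqrt_pos.2 (D.quadForm_pos hp)

theorem rootForm_sq {p : E × E} (hp : p ∈ slit M) : rootForm T B p ^ 2 =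
    (T p.1 - ‖p.1‖ ^ 2 * B p.1) * ‖p.2‖ ^ 2 + B p.1 * inner ℝ p.1 p.2 ^ 2 :=
  Real.sq_sqrt (D.quadForm_pos hp).le

theorem contDiffAt_comp_fst {k : E → ℝ} (hk : ContDiffOn ℝ ∞ k M) {p : E × E}
    (hp : p ∈ slit M) : ContDiffAt ℝ ∞ (fun p : E × E => k p.1) p :=
  (hk.contDiffAt (D.isOpen.mem_nhds hp.1)).comp p contDiffAt_fst

omit D in
theorem contDiffAt_norm_sq_fst (p : E × E) : ContDiffAt ℝ ∞ (fun p : E × E => ‖p.1‖ ^ 2) p :=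
  ((contDiff_norm_sq ℝ).comp contDiff_fst).contDiffAt

omit D in
theorem contDiffAt_norm_sq_snd (p : E × E) : ContDiffAt ℝ ∞ (fun p : E × E => ‖p.2‖ ^ 2) p :=
  ((contDiff_norm_sq ℝ).comp contDiff_snd).contDiffAt

omit D in
theorem contDiffAt_inner_fst_snd (p : E × E) :
    ContDiffAt ℝ ∞ (fun p : E × E => (inner ℝ p.1 p.2 : ℝ)) p :=
  contDiffAt_fst.inner ℝ contDiffAt_snd

theorem contDiffAt_denom {p : E × E} (hp : p ∈ slit M) :
    ContDiffAt ℝ ∞ (fun p : E × E => T p.1 - ‖p.1‖ ^ 2 * B p.1) p :=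
  (D.contDiffAt_comp_fst D.smooth_T hp).sub
    ((contDiffAt_norm_sq_fst p).mul (D.contDiffAt_comp_fst D.smooth_B hp))

theorem contDiffAt_rootForm {p : E × E} (hp : p ∈ slit M) :
    ContDiffAt ℝ ∞ (rootForm T B) p := by
  have h1 : ContDiffAt ℝ ∞ (quadForm T B) p :=
    ((D.contDiffAt_denom hp).mul (contDiffAt_norm_sq_snd p)).add
      ((D.contDiffAt_comp_fst D.smooth_B hp).mul ((contDiffAt_inner_fst_snd p).pow 2))
  exact h1.sqrt (D.quadForm_pos hp).ne'

theorem contDiffAt_finslerFun (ε : ℝ) {p : E × E} (hp : p ∈ slit M) :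
    ContDiffAt ℝ ∞ (finslerFun ε T B h) p := by
  have ha := D.contDiffAt_rootForm hp
  have hA := D.contDiffAt_denom hp
  have hS := contDiffAt_inner_fst_snd p
  have hR := contDiffAt_norm_sq_fst p
  have hT := D.contDiffAt_comp_fst D.smooth_T hp
  have a0 := (D.rootForm_pos hp).ne'
  have A0 := (D.pos_A _ hp.1).ne'
  unfold finslerFun profile
  exact (((contDiffAt_const.mul ha).div hA A0).add (((((hR.pow 2).mul ha).add
    ((((contDiffAt_const.mul hR).mul hT).mul (hS.pow 2)).div ha a0)).sub
    (((hT.pow 2).mul (hS.pow 4)).div (contDiffAt_const.mul (ha.pow 3))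
      (mul_ne_zero three_ne_zero (pow_ne_zero 3 a0)))).div (hA.pow 3) (pow_ne_zero 3 A0))).add
    (hS.mul (D.contDiffAt_comp_fst D.smooth_h hp))

theorem differentiableAt_coeffU (ε : ℝ) {p : E × E} (hp : p ∈ slit M) :
    DifferentiableAt ℝ (coeffU ε T B) p := by
  have ha := D.contDiffAt_rootForm hp
  have hS := contDiffAt_inner_fst_snd p
  have a0 := (D.rootForm_pos hp).ne'
  have h1 : ContDiffAt ℝ ∞ (coeffU ε T B) p :=
    (contDiffAt_const.add (((((contDiffAt_norm_sq_fst p).mul (contDiffAt_norm_sq_snd p)).sub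
      (hS.pow 2)).div (ha.pow 2) (pow_ne_zero 2 a0)).pow 2)).div ha a0
  exact h1.differentiableAt (by simp)

theorem differentiableAt_coeffV (ε : ℝ) {p : E × E} (hp : p ∈ slit M) :
    DifferentiableAt ℝ (coeffV ε T B h) p := by
  have ha := D.contDiffAt_rootForm hp
  have hA := D.contDiffAt_denom hp
  have hR := contDiffAt_norm_sq_fst p
  have hT := D.contDiffAt_comp_fst D.smooth_T hp
  have hB := D.contDiffAt_comp_fst D.smooth_B hp
  have a0 := (D.rootForm_pos hp).ne'
  have A0 := (D.pos_A _ hp.1).ne'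
  have hσ := (contDiffAt_inner_fst_snd p).div ha a0
  have h1 : ContDiffAt ℝ ∞ (coeffV ε T B h) p :=
    ((D.contDiffAt_comp_fst D.smooth_h hp).add ((((contDiffAt_const.mul hR).mul hT).mul hσ |>.sub
      ((contDiffAt_const.mul (hT.pow 2)).mul (hσ.pow 3))).div (hA.pow 3)
        (pow_ne_zero 3 A0))).add
    (((contDiffAt_const.div hA A0).add (((hR.sub (hT.mul (hσ.pow 2))).pow 2).div (hA.pow 3)
      (pow_ne_zero 3 A0))).mul (hB.mul hσ))
  exact h1.differentiableAt (by simp)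

/-- The terms in f cancel in ∇A = (4Tg − 2B) x, so f enters only through ∇B. -/
theorem hasDerivAt_line_rootForm {p : E × E} (hp : p ∈ slit M) (w : E × E) :
    HasDerivAt (fun t : ℝ => rootForm T B (p + t • w))
      ((((4 * T p.1 * g p.1 - 2 * B p.1) * ‖p.2‖ ^ 2 + 4 * T p.1 * f p.1 * inner ℝ p.1 p.2 ^ 2) *
          inner ℝ p.1 w.1 / 2 +
        (T p.1 - ‖p.1‖ ^ 2 * B p.1) * inner ℝ p.2 w.2 +
        B p.1 * inner ℝ p.1 p.2 * (inner ℝ p.1 w.2 + inner ℝ w.1 p.2)) / rootForm T B p) 0 := by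
  have hT := hasDerivAt_line_fst (D.deriv_T _ hp.1) p.2 w
  have hB := hasDerivAt_line_fst (D.deriv_B _ hp.1) p.2 w
  have hR := hasDerivAt_line_norm_fst p w
  have hN := hasDerivAt_line_norm_snd p w
  have hS := hasDerivAt_line_inner p w
  have h1 := ((hT.fun_sub (hR.fun_mul hB)).fun_mul hN).fun_add (hB.fun_mul (hS.fun_pow 2))
  have h2 := h1.sqrt (by
    have := (D.quadForm_pos hp).ne'
    simpa [quadForm] using this)
  refine h2.congr_deriv ?_
  have h3 : √((T p.1 - ‖p.1‖ ^ 2 * B p.1) * ‖p.2‖ ^ 2 + B p.1 * inner ℝ p.1 p.2 ^ 2) =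
    rootForm T B p := rfl
  have h4 := (D.rootForm_pos hp).ne'
  simp only [zero_smul, add_zero, Prod.mk.eta, h3, Nat.reduceSub, pow_one, Nat.cast_ofNat]
  field_simp
  ring

/-- All radial gradients are along x and ⟨x, y⟩ has x-gradient y. Hence F_x = X x + V y with the
same V as in F_y = U y + V x, which settles the y-component of Euler-Lagrange once U is constant. -/
theorem exists_fderiv_finslerFun (ε : ℝ) {p : E × E} (hp : p ∈ slit M) :
    ∃ c : ℝ, HasFDerivAt h (c • innerSL ℝ p.1) p.1 ∧ ∀ w : E × E,
      fderiv ℝ (finslerFun ε T B h) p w =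
        profileX ε (T p.1) (B p.1) c (‖p.1‖ ^ 2) (‖p.2‖ ^ 2) (inner ℝ p.1 p.2) (rootForm T B p)
          (g p.1) (f p.1) * inner ℝ p.1 w.1 + coeffV ε T B h p * inner ℝ p.2 w.1 +
        (coeffU ε T B p * inner ℝ p.2 w.2 + coeffV ε T B h p * inner ℝ p.1 w.2) := by
  obtain ⟨c, hc⟩ := D.deriv_h _ hp.1
  refine ⟨c, hc, fun w => ?_⟩
  have hT := hasDerivAt_line_fst (D.deriv_T _ hp.1) p.2 w
  have hB := hasDerivAt_line_fst (D.deriv_B _ hp.1) p.2 w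
  have hh := hasDerivAt_line_fst hc p.2 w
  have hR := hasDerivAt_line_norm_fst p w
  have hS := hasDerivAt_line_inner p w
  have ha := D.hasDerivAt_line_rootForm hp w
  have a0 := (D.rootForm_pos hp).ne'
  have A0 := (D.pos_A _ hp.1).ne'
  have h1 := hasDerivAt_profile (ε := ε) hT hB hh hR hS ha (by simpa using a0)
    (by simpa using A0)
  rw [fderiv_eq_of_line ((D.contDiffAt_finslerFun ε hp).differentiableAt (by simp)) h1]
  simp only [zero_smul, add_zero, Prod.mk.eta]
  rw [coeffU, coeffV, profileU_eq a0 A0 (D.rootForm_sq hp), profileV, profileX,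
    real_inner_comm p.2 w.1]
  ring

end RadialData
end Geometry
end SphFinsler
end

/-! ### Euler-Lagrange equation, strong convexity and vanishing Weyl defect -/

noncomputable section
namespace SphFinsler

open Filter Topology

section Rapcsak

variable {E : Type*} [NormedAddCommGroup E] [InnerProductSpace ℝ E]

namespace RadialData

variable {M : Set E} {T B h g f : E → ℝ} (D : RadialData M T B h g f)
include D

theorem fderiv_finslerFun_snd (ε : ℝ) {p : E × E} (hp : p ∈ slit M) (v : E) :
    fderiv ℝ (finslerFun ε T B h) p (0, v) =
      coeffU ε T B p * inner ℝ p.2 v + coeffV ε T B h p * inner ℝ p.1 v := by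
  obtain ⟨c, -, hc⟩ := D.exists_fderiv_finslerFun ε hp
  rw [hc]
  simp

theorem finslerFun_euler (ε : ℝ) {p : E × E} (hp : p ∈ slit M) :
    fderiv ℝ (finslerFun ε T B h) p (0, p.2) = finslerFun ε T B h p := by
  rw [D.fderiv_finslerFun_snd ε hp, finslerFun, profile_eq (D.rootForm_pos hp).ne'
    (D.pos_A _ hp.1).ne' (D.rootForm_sq hp), coeffU, coeffV, real_inner_self_eq_norm_sq]
  ring

theorem fderiv_fderiv_finslerFun (ε : ℝ) {p : E × E} (hp : p ∈ slit M) (w : E × E) (v : E) :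
    fderiv ℝ (fderiv ℝ (finslerFun ε T B h)) p w (0, v) =
      fderiv ℝ (coeffU ε T B) p w * inner ℝ p.2 v + coeffU ε T B p * inner ℝ w.2 v +
      (fderiv ℝ (coeffV ε T B h) p w * inner ℝ p.1 v + coeffV ε T B h p * inner ℝ w.1 v) := by
  have h1 : (fun p' => fderiv ℝ (finslerFun ε T B h) p' (0, v)) =ᶠ[𝓝 p] fun p' =>
      coeffU ε T B p' * inner ℝ p'.2 v + coeffV ε T B h p' * inner ℝ p'.1 v := by
    filter_upwards [(isOpen_slit D.isOpen).mem_nhds hp] with p' hp'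
    exact D.fderiv_finslerFun_snd ε hp' v
  have h2 : HasFDerivAt (fun p : E × E => (inner ℝ p.2 v : ℝ)) _ p :=
    hasFDerivAt_snd.inner ℝ (hasFDerivAt_const v p)
  have h3 : HasFDerivAt (fun p : E × E => (inner ℝ p.1 v : ℝ)) _ p :=
    hasFDerivAt_fst.inner ℝ (hasFDerivAt_const v p)
  rw [fderiv_fderiv_eq_of_eventuallyEq ((D.contDiffAt_finslerFun ε hp).of_le two_le_infty) h1
    (((D.differentiableAt_coeffU ε hp).hasFDerivAt.mul h2).add
      ((D.differentiableAt_coeffV ε hp).hasFDerivAt.mul h3)) w]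
  simp
  ring

omit D in
theorem hasDerivAt_line_wedge (p w : E × E) :
    HasDerivAt (fun t : ℝ => ‖(p + t • w).1‖ ^ 2 * ‖(p + t • w).2‖ ^ 2 -
        inner ℝ (p + t • w).1 (p + t • w).2 ^ 2)
      (2 * inner ℝ p.1 w.1 * ‖p.2‖ ^ 2 + ‖p.1‖ ^ 2 * (2 * inner ℝ p.2 w.2) -
        2 * inner ℝ p.1 p.2 * (inner ℝ p.1 w.2 + inner ℝ w.1 p.2)) 0 := by
  have h1 := ((hasDerivAt_line_norm_fst p w).fun_mul (hasDerivAt_line_norm_snd p w)).fun_sub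
    ((hasDerivAt_line_inner p w).fun_pow 2)
  refine h1.congr_deriv ?_
  simp

theorem fderiv_coeffU (ε : ℝ) {p : E × E} (hp : p ∈ slit M) {w : E × E} {a' W' : ℝ}
    (ha : HasDerivAt (fun t : ℝ => rootForm T B (p + t • w)) a' 0)
    (hW : HasDerivAt (fun t : ℝ => ‖(p + t • w).1‖ ^ 2 * ‖(p + t • w).2‖ ^ 2 -
        inner ℝ (p + t • w).1 (p + t • w).2 ^ 2) W' 0) :
    fderiv ℝ (coeffU ε T B) p w = -(ε * a') / rootForm T B p ^ 2 +
      2 * (‖p.1‖ ^ 2 * ‖p.2‖ ^ 2 - inner ℝ p.1 p.2 ^ 2) * W' / rootForm T B p ^ 5 -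
      5 * (‖p.1‖ ^ 2 * ‖p.2‖ ^ 2 - inner ℝ p.1 p.2 ^ 2) ^ 2 * a' / rootForm T B p ^ 6 := by
  have h1 := hasDerivAt_profileU (ε := ε) hW ha (by simpa using (D.rootForm_pos hp).ne')
  rw [fderiv_eq_of_line (D.differentiableAt_coeffU ε hp) h1]
  simp

theorem eulerLagrange (ε : ℝ) {p : E × E} (hp : p ∈ slit M) (v : E) :
    fderiv ℝ (fderiv ℝ (finslerFun ε T B h)) p (p.2, -(2 * quadFactor g f p) • p.1) (0, v) =
      fderiv ℝ (finslerFun ε T B h) p (v, 0) := by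
  obtain ⟨c, hc, hF⟩ := D.exists_fderiv_finslerFun ε hp
  have a0 := (D.rootForm_pos hp).ne'
  have A0 := (D.pos_A _ hp.1).ne'
  set w : E × E := (p.2, -(2 * quadFactor g f p) • p.1) with hw
  have w1 : w.1 = p.2 := rfl
  have w2 : w.2 = -(2 * quadFactor g f p) • p.1 := rfl
  have hxw : inner ℝ p.1 w.2 = -(2 * quadFactor g f p) * ‖p.1‖ ^ 2 := by
    rw [w2, inner_smul_right, real_inner_self_eq_norm_sq]
  have hyw : inner ℝ p.2 w.2 = -(2 * quadFactor g f p) * inner ℝ p.1 p.2 := by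
    rw [w2, inner_smul_right, real_inner_comm]
  have hyy : inner ℝ w.1 p.2 = ‖p.2‖ ^ 2 := by rw [w1, real_inner_self_eq_norm_sq]
  -- Both a and W are stationary in the direction (y, −2qx), and U depends on these two alone.
  have ha : HasDerivAt (fun t : ℝ => rootForm T B (p + t • w)) 0 0 := by
    refine (D.hasDerivAt_line_rootForm hp w).congr_deriv ?_
    rw [hxw, hyw, hyy, w1, quadFactor_eq]
    field_simp
    ring
  have hW : HasDerivAt (fun t : ℝ => ‖(p + t • w).1‖ ^ 2 * ‖(p + t • w).2‖ ^ 2 -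
      inner ℝ (p + t • w).1 (p + t • w).2 ^ 2) 0 0 := by
    refine (hasDerivAt_line_wedge p w).congr_deriv ?_
    rw [hxw, hyw, hyy, w1]
    ring
  have hU : fderiv ℝ (coeffU ε T B) p w = 0 := by
    rw [D.fderiv_coeffU ε hp ha hW]
    simp
  have hV : fderiv ℝ (coeffV ε T B h) p w =
      profileX ε (T p.1) (B p.1) c (‖p.1‖ ^ 2) (‖p.2‖ ^ 2) (inner ℝ p.1 p.2) (rootForm T B p)
          (g p.1) (f p.1) + 2 * quadFactor g f p * coeffU ε T B p := by
    have hT := hasDerivAt_line_fst (D.deriv_T _ hp.1) p.2 w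
    have hB := hasDerivAt_line_fst (D.deriv_B _ hp.1) p.2 w
    have hh := hasDerivAt_line_fst hc p.2 w
    have h1 := hasDerivAt_profileV (ε := ε) hT hB hh (hasDerivAt_line_norm_fst p w)
      (hasDerivAt_line_inner p w) ha (by simpa using a0) (by simpa using A0)
    rw [fderiv_eq_of_line (D.differentiableAt_coeffV ε hp) h1, quadFactor_eq, coeffU,
      ← profileV_along_spray a0 A0 (D.rootForm_sq hp)]
    simp only [zero_smul, add_zero, Prod.mk.eta]
    rw [hxw, hyy, w1, quadFactor_eq]
    ring
  rw [D.fderiv_fderiv_finslerFun ε hp, hU, hV, hF, w1, w2, inner_smul_left]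
  simp
  ring

theorem fderiv_fderiv_finslerFun_snd (ε : ℝ) {p : E × E} (hp : p ∈ slit M) (u : E) :
    fderiv ℝ (fderiv ℝ (finslerFun ε T B h)) p (0, u) (0, u) =
      (coeffU ε T B p * (‖u‖ ^ 2 * ‖p.2‖ ^ 2 - inner ℝ p.2 u ^ 2) +
        (ε * B p.1 + 4 * ((‖p.1‖ ^ 2 * ‖p.2‖ ^ 2 - inner ℝ p.1 p.2 ^ 2) / rootForm T B p ^ 2) +
          5 * B p.1 * ((‖p.1‖ ^ 2 * ‖p.2‖ ^ 2 - inner ℝ p.1 p.2 ^ 2) / rootForm T B p ^ 2) ^ 2) /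
            rootForm T B p ^ 3 *
          (‖p.2‖ ^ 2 * inner ℝ p.1 u - inner ℝ p.1 p.2 * inner ℝ p.2 u) ^ 2) / ‖p.2‖ ^ 2 := by
  have a0 := (D.rootForm_pos hp).ne'
  have A0 := (D.pos_A _ hp.1).ne'
  have N0 : ‖p.2‖ ^ 2 ≠ 0 := pow_ne_zero 2 (norm_ne_zero_iff.2 hp.2)
  obtain ⟨c, hc⟩ := D.deriv_h _ hp.1
  have ha := D.hasDerivAt_line_rootForm hp (0, u)
  have hT := hasDerivAt_line_fst (D.deriv_T _ hp.1) p.2 (0, u)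
  have hB := hasDerivAt_line_fst (D.deriv_B _ hp.1) p.2 (0, u)
  have hh := hasDerivAt_line_fst hc p.2 (0, u)
  have h1 := hasDerivAt_profileV (ε := ε) hT hB hh (hasDerivAt_line_norm_fst p (0, u))
    (hasDerivAt_line_inner p (0, u)) ha (by simpa using a0) (by simpa using A0)
  rw [D.fderiv_fderiv_finslerFun ε hp, D.fderiv_coeffU ε hp ha (hasDerivAt_line_wedge p (0, u)),
    fderiv_eq_of_line (D.differentiableAt_coeffV ε hp) h1, coeffU,
    ← profile_hessian a0 A0 N0 (D.rootForm_sq hp)]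
  simp only [zero_smul, add_zero, Prod.mk.eta, inner_zero_right, inner_zero_left, mul_zero,
    zero_div, zero_add, sub_zero, zero_mul, real_inner_self_eq_norm_sq]
  ring

/-- The fibre Hessian is nonnegative, and degenerate only along the ray. -/
theorem fderiv_fderiv_finslerFun_pos {ε : ℝ} (hε : 0 < ε) {p : E × E} (hp : p ∈ slit M) {u : E}
    (hu : inner ℝ p.2 u ^ 2 < ‖u‖ ^ 2 * ‖p.2‖ ^ 2) :
    0 < fderiv ℝ (fderiv ℝ (finslerFun ε T B h)) p (0, u) (0, u) := by
  rw [D.fderiv_fderiv_finslerFun_snd ε hp]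
  have a0 := D.rootForm_pos hp
  have hN : 0 < ‖p.2‖ ^ 2 := by
    have := norm_pos_iff.2 hp.2
    positivity
  have hW : 0 ≤ ‖p.1‖ ^ 2 * ‖p.2‖ ^ 2 - inner ℝ p.1 p.2 ^ 2 := sub_nonneg.2 (inner_sq_le p)
  have ha2 := D.rootForm_sq hp
  have hT := D.pos_T _ hp.1
  -- Cauchy-Schwarz for Nx − Sy and Nu − ⟨y, u⟩y, multiples of the components of x and u orthogonal
  -- to y; a common factor N² is divided out.
  have hgram : (‖p.2‖ ^ 2 * inner ℝ p.1 u - inner ℝ p.1 p.2 * inner ℝ p.2 u) ^ 2 ≤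
      (‖p.1‖ ^ 2 * ‖p.2‖ ^ 2 - inner ℝ p.1 p.2 ^ 2) *
        (‖u‖ ^ 2 * ‖p.2‖ ^ 2 - inner ℝ p.2 u ^ 2) := by
    have h1 := inner_sq_le (‖p.2‖ ^ 2 • p.1 - (inner ℝ p.1 p.2 : ℝ) • p.2,
      ‖p.2‖ ^ 2 • u - (inner ℝ p.2 u : ℝ) • p.2)
    simp only [← real_inner_self_eq_norm_sq (_ - _), inner_sub_left, inner_sub_right,
      real_inner_smul_left, real_inner_smul_right, real_inner_comm p.2 u] at h1
    rw [real_inner_comm p.1 p.2, real_inner_self_eq_norm_sq p.2, real_inner_self_eq_norm_sq p.1,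
      real_inner_self_eq_norm_sq u] at h1
    refine le_of_mul_le_mul_left ?_ (by positivity : 0 < (‖p.2‖ ^ 2) ^ 2)
    linarith
  set N := ‖p.2‖ ^ 2
  set W := ‖p.1‖ ^ 2 * N - inner ℝ p.1 p.2 ^ 2 with hWdef
  set X := ‖u‖ ^ 2 * N - inner ℝ p.2 u ^ 2 with hX
  set Y := (N * inner ℝ p.1 u - inner ℝ p.1 p.2 * inner ℝ p.2 u) ^ 2
  set a := rootForm T B p
  have hY : 0 ≤ Y := sq_nonneg _
  have hX0 : 0 < X := sub_pos.2 hu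
  refine div_pos ?_ hN
  set τ := W / a ^ 2 with hτ
  have hU : coeffU ε T B p = (ε + τ ^ 2) / a := rfl
  have hU0 : 0 < coeffU ε T B p := by rw [hU]; positivity
  set Z := (ε * B p.1 + 4 * τ + 5 * B p.1 * τ ^ 2) / a ^ 3 with hZ
  -- If Z < 0, the Gram inequality bounds the Hessian below by (U + ZW)X/N. Here a² + BW = TN, and
  -- 4τW = 4τ²a² joins the τ² of U to give 5τ².
  have hsum : 0 < coeffU ε T B p + Z * W := by
    have h1 : coeffU ε T B p + Z * W = T p.1 * N * (ε + 5 * τ ^ 2) / a ^ 3 := by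
      have h2 : a ^ 2 + B p.1 * W = T p.1 * N := by rw [ha2, hWdef]; ring
      rw [← h2, hU, hZ, hτ]
      field_simp
      ring
    rw [h1]
    positivity
  rcases le_total 0 Z with h0 | h0
  · positivity
  · nlinarith [mul_le_mul_of_nonpos_left hgram h0, mul_pos hsum hX0]

theorem contDiffAt_quadFactor {p : E × E} (hp : p ∈ slit M) :
    ContDiffAt ℝ ∞ (quadFactor g f) p :=
  ((D.contDiffAt_comp_fst D.smooth_g hp).mul (contDiffAt_norm_sq_snd p)).add
    ((contDiffAt_inner_fst_snd p).mul
      (((D.smooth_f.contDiffAt (D.isOpen.mem_nhds hp.1)).comp p contDiffAt_fst).inner ℝ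
        contDiffAt_snd))

theorem fderiv_quadFactor_snd {p : E × E} (hp : p ∈ slit M) (u : E) :
    fderiv ℝ (quadFactor g f) p (0, u) =
      2 * g p.1 * inner ℝ p.2 u + 2 * f p.1 * inner ℝ p.1 p.2 * inner ℝ p.1 u := by
  refine fderiv_eq_of_line ((D.contDiffAt_quadFactor hp).differentiableAt (by simp)) ?_
  have h1 := ((hasDerivAt_line_norm_snd p (0, u)).const_mul (g p.1)).fun_add
    (((hasDerivAt_line_inner p (0, u)).fun_pow 2).const_mul (f p.1))
  simp only [quadFactor_eq]
  have h2 : ∀ t : ℝ, (p + t • ((0 : E), u)).1 = p.1 := fun t => by simp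
  simp only [h2] at h1 ⊢
  refine h1.congr_deriv ?_
  simp
  ring

/-- The derivative of f cancels of itself; the remaining terms cancel by the formula for ∇g. At x =
0, where f need not be differentiable, the factor x suffices. -/
theorem weylDefect_quadFactor {p : E × E} (hp : p ∈ slit M) (u : E) :
    weylDefect (quadFactor g f) p u • p.1 = 0 := by
  rcases eq_or_ne p.1 0 with hx0 | hx0
  · rw [hx0, smul_zero]
  obtain ⟨c, hc⟩ := D.deriv_f _ hp.1 hx0
  have hg := D.deriv_g _ hp.1
  have hk : (fun p' => fderiv ℝ (quadFactor g f) p' (0, u)) =ᶠ[𝓝 p] fun p' =>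
      2 * g p'.1 * inner ℝ p'.2 u + 2 * f p'.1 * inner ℝ p'.1 p'.2 * inner ℝ p'.1 u := by
    filter_upwards [(isOpen_slit D.isOpen).mem_nhds hp] with p' hp'
    exact D.fderiv_quadFactor_snd hp' u
  have dg : DifferentiableAt ℝ (fun p : E × E => g p.1) p :=
    hg.differentiableAt.comp p differentiableAt_fst
  have df : DifferentiableAt ℝ (fun p : E × E => f p.1) p :=
    hc.differentiableAt.comp p differentiableAt_fst
  have dk : DifferentiableAt ℝ (fun p' : E × E => 2 * g p'.1 * inner ℝ p'.2 u +
      2 * f p'.1 * inner ℝ p'.1 p'.2 * inner ℝ p'.1 u) p :=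
    ((dg.const_mul 2).fun_mul (differentiableAt_snd.inner ℝ (differentiableAt_const u))).fun_add
      (((df.const_mul 2).fun_mul (differentiableAt_fst.inner ℝ differentiableAt_snd)).fun_mul
        (differentiableAt_fst.inner ℝ (differentiableAt_const u)))
  have e1 : fderiv ℝ (quadFactor g f) p (u, 0) =
      (f p.1 * (1 - 2 * ‖p.1‖ ^ 2 * g p.1) - 2 * g p.1 ^ 2) * inner ℝ p.1 u * ‖p.2‖ ^ 2 +
      c * inner ℝ p.1 u * inner ℝ p.1 p.2 ^ 2 + 2 * f p.1 * inner ℝ p.1 p.2 * inner ℝ p.2 u := by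
    refine fderiv_eq_of_line ((D.contDiffAt_quadFactor hp).differentiableAt (by simp)) ?_
    have h1 := ((hasDerivAt_line_fst hg p.2 (u, 0)).fun_mul
      (hasDerivAt_line_norm_snd p (u, 0))).fun_add
      ((hasDerivAt_line_fst hc p.2 (u, 0)).fun_mul ((hasDerivAt_line_inner p (u, 0)).fun_pow 2))
    simp only [quadFactor_eq]
    refine h1.congr_deriv ?_
    simp [real_inner_comm p.2 u]
    ring
  have e2 : fderiv ℝ (fderiv ℝ (quadFactor g f)) p (p.2, -(2 * quadFactor g f p) • p.1) (0, u) =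
      2 * (f p.1 * (1 - 2 * ‖p.1‖ ^ 2 * g p.1) - 2 * g p.1 ^ 2) * inner ℝ p.1 p.2 *
        inner ℝ p.2 u - 4 * g p.1 * quadFactor g f p * inner ℝ p.1 u +
      2 * c * inner ℝ p.1 p.2 ^ 2 * inner ℝ p.1 u +
      2 * f p.1 * (‖p.2‖ ^ 2 - 2 * quadFactor g f p * ‖p.1‖ ^ 2) * inner ℝ p.1 u +
      2 * f p.1 * inner ℝ p.1 p.2 * inner ℝ p.2 u := by
    rw [fderiv_fderiv_eq_of_eventuallyEq ((D.contDiffAt_quadFactor hp).of_le two_le_infty) hk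
      dk.hasFDerivAt]
    refine fderiv_eq_of_line dk ?_
    set w : E × E := (p.2, -(2 * quadFactor g f p) • p.1) with hw
    have i1 : HasDerivAt (fun t : ℝ => (inner ℝ (p + t • w).1 u : ℝ)) (inner ℝ w.1 u) 0 := by
      have h1 : HasFDerivAt (fun p : E × E => (inner ℝ p.1 u : ℝ)) _ p :=
        hasFDerivAt_fst.inner ℝ (hasFDerivAt_const u p)
      simpa using hasDerivAt_line h1 w
    have i2 : HasDerivAt (fun t : ℝ => (inner ℝ (p + t • w).2 u : ℝ)) (inner ℝ w.2 u) 0 := by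
      have h1 : HasFDerivAt (fun p : E × E => (inner ℝ p.2 u : ℝ)) _ p :=
        hasFDerivAt_snd.inner ℝ (hasFDerivAt_const u p)
      simpa using hasDerivAt_line h1 w
    have h1 := (((hasDerivAt_line_fst hg p.2 w).const_mul 2).fun_mul i2).fun_add
      ((((hasDerivAt_line_fst hc p.2 w).const_mul 2).fun_mul
        (hasDerivAt_line_inner p w)).fun_mul i1)
    refine h1.congr_deriv ?_
    have w1 : w.1 = p.2 := rfl
    have w2 : w.2 = -(2 * quadFactor g f p) • p.1 := rfl
    simp only [zero_smul, add_zero, Prod.mk.eta]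
    rw [w1, w2, real_inner_smul_right, real_inner_smul_left, real_inner_self_eq_norm_sq,
      real_inner_self_eq_norm_sq]
    ring
  rw [weylDefect, e1, e2, D.fderiv_quadFactor_snd hp, D.fderiv_quadFactor_snd hp,
    real_inner_comm p.1 p.2, real_inner_self_eq_norm_sq, quadFactor_eq]
  convert zero_smul ℝ p.1 using 2
  ring

theorem isRapcsak {ε : ℝ} (hpos : ∀ p ∈ slit M, 0 < finslerFun ε T B h p) :
    IsRapcsak M (finslerFun ε T B h) (quadFactor g f) where
  isOpen := D.isOpen
  smooth _ hp := (D.contDiffAt_finslerFun ε hp).contDiffWithinAt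
  smooth_q _ hp := (D.contDiffAt_quadFactor hp).contDiffWithinAt
  pos := hpos
  euler _ hp := D.finslerFun_euler ε hp
  euler_q p hp := by
    rw [D.fderiv_quadFactor_snd hp, quadFactor_eq, real_inner_self_eq_norm_sq]
    ring
  eulerLagrange _ hp v := D.eulerLagrange ε hp v

end RadialData
end Rapcsak
end SphFinsler
end

/-! ### Assembly for the spherically symmetric metric -/

noncomputable section
namespace SphFinsler

open Filter Topology

theorem IsRapcsak.congr {E : Type*} [NormedAddCommGroup E] [NormedSpace ℝ E] {M : Set E}
    {f f' q : E × E → ℝ} (h : IsRapcsak M f q) (hf : ∀ p ∈ slit M, f' p = f p) :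
    IsRapcsak M f' q := by
  have h1 : ∀ p ∈ slit M, f' =ᶠ[𝓝 p] f := fun p hp => by
    filter_upwards [h.mem_nhds hp] with p' hp' using hf p' hp'
  refine ⟨h.isOpen, h.smooth.congr hf, h.smooth_q, fun p hp => hf p hp ▸ h.pos p hp,
    fun p hp => ?_, h.euler_q, fun p hp v => ?_⟩
  · rw [(h1 p hp).fderiv_eq, hf p hp, h.euler p hp]
  · rw [(h1 p hp).fderiv.fderiv_eq, (h1 p hp).fderiv_eq, h.eulerLagrange p hp]

/-- Strong convexity transversally to the rays gives a positive definite fundamental tensor. -/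
theorem IsRapcsak.posDef {E : Type*} [NormedAddCommGroup E] [InnerProductSpace ℝ E] {M : Set E}
    {f q : E × E → ℝ} (h : IsRapcsak M f q) {p : E × E} (hp : p ∈ slit M)
    (hpos : ∀ u, inner ℝ p.2 u ^ 2 < ‖u‖ ^ 2 * ‖p.2‖ ^ 2 →
      0 < fderiv ℝ (fderiv ℝ f) p (0, u) (0, u)) {u : E} (hu : u ≠ 0) :
    0 < f p * fderiv ℝ (fderiv ℝ f) p (0, u) (0, u) +
      fderiv ℝ f p (0, u) * fderiv ℝ f p (0, u) := by
  have hf := h.pos p hp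
  rcases lt_or_ge (inner ℝ p.2 u ^ 2) (‖u‖ ^ 2 * ‖p.2‖ ^ 2) with h1 | h1
  · have := hpos u h1
    have := mul_self_nonneg (fderiv ℝ f p (0, u))
    positivity
  · have hN : 0 < ‖p.2‖ ^ 2 := by
      have := norm_pos_iff.2 hp.2
      positivity
    set c : ℝ := inner ℝ p.2 u / ‖p.2‖ ^ 2 with hc
    have h2 : u = c • p.2 := by
      rw [← sub_eq_zero, ← inner_self_eq_zero (𝕜 := ℝ)]
      refine le_antisymm ?_ real_inner_self_nonneg
      have h3 : inner ℝ (u - c • p.2) (u - c • p.2) =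
          (‖u‖ ^ 2 * ‖p.2‖ ^ 2 - inner ℝ p.2 u ^ 2) / ‖p.2‖ ^ 2 := by
        simp only [inner_sub_left, inner_sub_right, real_inner_smul_left, real_inner_smul_right,
          real_inner_comm p.2 u]
        rw [real_inner_self_eq_norm_sq, real_inner_self_eq_norm_sq, hc]
        have := norm_ne_zero_iff.2 hp.2
        field_simp
        ring
      rw [h3]
      exact div_nonpos_of_nonpos_of_nonneg (by linarith) hN.le
    have hc0 : c ≠ 0 := by
      rintro h0
      rw [h0, zero_smul] at h2
      exact hu h2
    have h4 : ((0 : E), u) = c • ((0 : E), p.2) := by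
      rw [Prod.smul_mk, smul_zero, ← h2]
    have h5 : fderiv ℝ (fderiv ℝ f) p (0, u) (0, u) = 0 := by
      conv_lhs => rw [h4]
      rw [map_smul, map_smul, smul_apply, h.fderiv_fderiv_euler hp]
      simp [Prod.mk_zero_zero]
    rw [h5, h4, map_smul, h.euler p hp, smul_eq_mul]
    have := mul_self_pos.2 (mul_ne_zero hc0 hf.ne')
    linarith

theorem radialData_of_isTPair {n : ℕ} (hn : 2 ≤ n) {I : Set ℝ} (hI : IsRadiusInterval I)
    {g h T Tbar : ℝ → ℝ}
    (hg : ContDiffOn ℝ ∞ (fun x : EuclideanSpace ℝ (Fin n) => g ‖x‖) (symDomain n I))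
    (hh : ContDiffOn ℝ ∞ (fun x : EuclideanSpace ℝ (Fin n) => h ‖x‖) (symDomain n I))
    (hT : IsTPair I g T Tbar) (hA : ∀ r ∈ I, 0 < T r - r ^ 2 * Tbar r) :
    RadialData (symDomain n I) (fun x => T ‖x‖) (fun x => Tbar ‖x‖) (fun x => h ‖x‖)
      (fun x => g ‖x‖) (fun x => quadCoeff I g ‖x‖) where
  isOpen := hI.isOpen_symDomain n
  smooth_T := (hT.contDiffOn_fst_and_hasFDerivAt hI hn hg).1
  smooth_B := (hT.contDiffOn_snd_and_hasFDerivAt hI hn hg).1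
  smooth_h := hh
  smooth_g := hg
  smooth_f := contDiffOn_quadCoeff_smul hI hn hg hT
  deriv_T := (hT.contDiffOn_fst_and_hasFDerivAt hI hn hg).2
  deriv_B := (hT.contDiffOn_snd_and_hasFDerivAt hI hn hg).2
  deriv_h _ hx := ⟨_, hasFDerivAt_radial hI hn hh hx⟩
  deriv_g x hx := by
    refine (hasFDerivAt_radial hI hn hg hx).congr_fderiv ?_
    have := hT.1 _ hx
    rw [quadCoeff, div_mul_cancel₀ _ this, add_sub_cancel_right]
  deriv_f _ hx hx0 := exists_hasFDerivAt_quadCoeff hI hn hg hT hx hx0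
  pos_T _ hx := hT.pos hx
  pos_A _ hx := hA _ hx

/-- With b² = D one has A(r² − s²) = r²b² − Ts², which turns the numerator into r⁴b⁴ + 2r²Ts²b² −
T²s⁴/3. -/
theorem phiTwo_eq_profile {T Tbar h : ℝ → ℝ} {ε r s : ℝ}
    (hD : 0 < T r - Tbar r * (r ^ 2 - s ^ 2)) (hA : T r - r ^ 2 * Tbar r ≠ 0) :
    phiTwo T Tbar h ε r s = profile ε (T r) (Tbar r) (h r) (r ^ 2) s
      √(T r - Tbar r * (r ^ 2 - s ^ 2)) := by
  have hb := Real.sqrt_pos.2 hD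
  have hb2 := Real.sq_sqrt hD.le
  unfold phiTwo profile
  generalize √(T r - Tbar r * (r ^ 2 - s ^ 2)) = b at *
  rw [← hb2]
  generalize T r = T, Tbar r = B, h r = h at *
  generalize r ^ 2 = R at *
  have h1 : (T - R * B) * (R - s ^ 2) = R * b ^ 2 - T * s ^ 2 := by
    linear_combination (-R) * hb2
  rw [h1]
  clear hb2 hD h1
  generalize T - R * B = A at *
  field_simp
  ring

theorem discriminant_pos {t b r s : ℝ} (ht : 0 < t) (hA : 0 < t - r ^ 2 * b) (hs : |s| ≤ r) :
    0 < t - b * (r ^ 2 - s ^ 2) := by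
  have h1 : s ^ 2 ≤ r ^ 2 := sq_le_sq' (neg_le_of_abs_le hs) (le_of_abs_le hs)
  rcases le_total 0 b with hb | hb
  · nlinarith [mul_nonneg hb (sq_nonneg s)]
  · nlinarith

/-- For |y| = 1, φ = U + sV and ∂φ/∂s = V, so φ/s has derivative −U/s²; and η of `varphi` is √(r² −
s²) U. -/
theorem hasDerivAt_phiTwo_div {T Tbar h : ℝ → ℝ} {ε r s : ℝ} (hT : 0 < T r)
    (hA : 0 < T r - r ^ 2 * Tbar r) (hs : s ≠ 0) (hsr : |s| < r) :
    HasDerivAt (fun t => phiTwo T Tbar h ε r t / t)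
      (-(eta 2 ε (varphi T Tbar r s) / (s ^ 2 * √(r ^ 2 - s ^ 2)))) s := by
  have hD := discriminant_pos hT hA hsr.le
  have hw : 0 < r ^ 2 - s ^ 2 := sub_pos.2 (sq_lt_sq' (neg_lt_of_abs_lt hsr) (lt_of_abs_lt hsr))
  set b := √(T r - Tbar r * (r ^ 2 - s ^ 2)) with hb
  have hb0 : 0 < b := Real.sqrt_pos.2 hD
  have hb2 : b ^ 2 = T r - Tbar r * (r ^ 2 - s ^ 2) := Real.sq_sqrt hD.le
  have hb3 : b ^ 2 = (T r - r ^ 2 * Tbar r) * 1 + Tbar r * s ^ 2 := by rw [hb2]; ring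
  have ha : HasDerivAt (fun t => √(T r - Tbar r * (r ^ 2 - t ^ 2))) (Tbar r * s / b) s := by
    have h1 := ((((hasDerivAt_id s).fun_pow 2).const_sub (r ^ 2)).const_mul (Tbar r)).const_sub
      (T r)
    refine (h1.sqrt hD.ne').congr_deriv ?_
    simp only [id, ← hb]
    field_simp
    ring
  have h1 := hasDerivAt_profile (ε := ε) (hasDerivAt_const s (T r)) (hasDerivAt_const s (Tbar r))
    (hasDerivAt_const s (h r)) (hasDerivAt_const s (r ^ 2)) (hasDerivAt_id s) ha hb0.ne' hA.ne'
  have h2 : (fun t => phiTwo T Tbar h ε r t / t) =ᶠ[𝓝 s] fun t =>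
      profile ε (T r) (Tbar r) (h r) (r ^ 2) (id t) √(T r - Tbar r * (r ^ 2 - t ^ 2)) / id t := by
    filter_upwards [(continuous_abs.tendsto s).eventually (gt_mem_nhds hsr)] with t ht
    rw [phiTwo_eq_profile (discriminant_pos hT hA (le_of_lt ht)) hA.ne']
    rfl
  refine ((h1.fun_div (hasDerivAt_id s) hs).congr_of_eventuallyEq h2).congr_deriv ?_
  simp only [id, ← hb]
  have e1 := profile_eq (ε := ε) (h := h r) hb0.ne' hA.ne' hb3
  have e2 : eta 2 ε (varphi T Tbar r s) / (s ^ 2 * √(r ^ 2 - s ^ 2)) =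
      profileU ε (r ^ 2 * 1 - s ^ 2) b / s ^ 2 := by
    have e3 : -varphi T Tbar r s = (r ^ 2 - s ^ 2) / b ^ 2 := by
      rw [varphi, ← div_neg, hb2]
      congr 1
      ring
    rw [eta, e3, Real.sqrt_div hw.le, Real.sqrt_sq hb0.le, profileU, mul_one]
    have := Real.sqrt_pos.2 hw
    field_simp
    ring
  rw [e2, e1, profileV]
  field_simp
  ring

/-- Homogeneity of `profile` in (S, a), since √D at s = S/|y| equals a/|y|. -/
theorem sphMetric_eq_finslerFun {n : ℕ} {I : Set ℝ} {g h T Tbar f : ℝ → ℝ} {ε : ℝ}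
    (D : RadialData (symDomain n I) (fun x => T ‖x‖) (fun x => Tbar ‖x‖) (fun x => h ‖x‖)
      (fun x => g ‖x‖) (fun x => f ‖x‖))
    {p : EuclideanSpace ℝ (Fin n) × EuclideanSpace ℝ (Fin n)} (hp : p ∈ slit (symDomain n I)) :
    sphMetric n (phiTwo T Tbar h ε) p.1 p.2 =
      finslerFun ε (fun x => T ‖x‖) (fun x => Tbar ‖x‖) (fun x => h ‖x‖) p := by
  have hk : 0 < ‖p.2‖ := norm_pos_iff.2 hp.2
  have hA := D.pos_A _ hp.1
  have ha := D.rootForm_pos hp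
  have ha2 := D.rootForm_sq hp
  set a := rootForm (fun x => T ‖x‖) (fun x => Tbar ‖x‖) p with hadef
  have hD : T ‖p.1‖ - Tbar ‖p.1‖ * (‖p.1‖ ^ 2 - (inner ℝ p.1 p.2 / ‖p.2‖) ^ 2) =
      (a / ‖p.2‖) ^ 2 := by
    rw [div_pow a, ha2]
    field_simp
    ring
  rw [sphMetric, phiTwo_eq_profile (by rw [hD]; positivity) hA.ne', hD,
    Real.sqrt_sq (by positivity), finslerFun, ← hadef]
  unfold profile
  field_simp

theorem abs_inner_div_norm_le {n : ℕ} (x y : EuclideanSpace ℝ (Fin n)) :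
    |inner ℝ x y / ‖y‖| ≤ ‖x‖ := by
  rw [abs_div, abs_norm]
  exact div_le_of_le_mul₀ (norm_nonneg _) (norm_nonneg _) (abs_real_inner_le_norm x y)

theorem isFinslerMetric_and_isRapcsak {n : ℕ} (hn : 2 ≤ n) {I : Set ℝ} (hI : IsRadiusInterval I)
    {g h T Tbar : ℝ → ℝ} {ε : ℝ} (hε : 0 < ε)
    (hg : ContDiffOn ℝ ∞ (fun x : EuclideanSpace ℝ (Fin n) => g ‖x‖) (symDomain n I))
    (hh : ContDiffOn ℝ ∞ (fun x : EuclideanSpace ℝ (Fin n) => h ‖x‖) (symDomain n I))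
    (hT : IsTPair I g T Tbar) (hA : ∀ r ∈ I, 0 < T r - r ^ 2 * Tbar r)
    (hpos : ∀ r ∈ I, ∀ s : ℝ, |s| ≤ r → 0 < phiTwo T Tbar h ε r s) :
    IsFinslerMetric (symDomain n I) (sphMetric n (phiTwo T Tbar h ε)) ∧
    IsRapcsak (symDomain n I) (fun p => sphMetric n (phiTwo T Tbar h ε) p.1 p.2)
      (quadFactor (fun x => g ‖x‖) (fun x => quadCoeff I g ‖x‖)) := by
  have D := radialData_of_isTPair hn hI hg hh hT hA
  have heq : ∀ p ∈ slit (symDomain n I), sphMetric n (phiTwo T Tbar h ε) p.1 p.2 = _ :=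
    fun p hp => sphMetric_eq_finslerFun (ε := ε) D hp
  have hF0 : ∀ x ∈ symDomain n I, ∀ y, y ≠ 0 →
      0 < sphMetric n (phiTwo T Tbar h ε) x y := fun x hx y hy =>
    mul_pos (norm_pos_iff.2 hy) (hpos _ hx _ (abs_inner_div_norm_le x y))
  have hR0 := D.isRapcsak (ε := ε) fun p hp => heq p hp ▸ hF0 _ hp.1 _ hp.2
  have hR := hR0.congr heq
  refine ⟨⟨fun x hx y => ?_, hR.smooth, fun x _ y c hc => ?_, fun x hx y hy u hu => ?_⟩, hR⟩
  · rcases eq_or_ne y 0 with rfl | hy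
    · simp [sphMetric]
    · exact (hF0 x hx y hy).le
  · rw [sphMetric, sphMetric, norm_smul, Real.norm_of_nonneg hc.le, real_inner_smul_right,
      mul_div_mul_left _ _ hc.ne', mul_assoc]
  · have hp : (x, y) ∈ slit (symDomain n I) := ⟨hx, hy⟩
    rw [gInner_eq (hR.contDiffAt_two hp)]
    refine hR.posDef hp (fun v hv => ?_) hu
    have h1 : (fun p : EuclideanSpace ℝ (Fin n) × EuclideanSpace ℝ (Fin n) =>
        sphMetric n (phiTwo T Tbar h ε) p.1 p.2) =ᶠ[𝓝 (x, y)]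
        finslerFun ε (fun x => T ‖x‖) (fun x => Tbar ‖x‖) (fun x => h ‖x‖) := by
      filter_upwards [hR.mem_nhds hp] with p' hp' using heq p' hp'
    rw [h1.fderiv.fderiv_eq]
    exact D.fderiv_fderiv_finslerFun_pos hε hp hv

end SphFinsler
end

theorem mainTheorem10 (n : ℕ) (hn : 2 ≤ n) (I : Set ℝ) (hI : SphFinsler.IsRadiusInterval I)
    (g h T Tbar : ℝ → ℝ) (ε : ℝ) (hε : 0 < ε)
    (hg : ContDiffOn ℝ ∞ (fun x : EuclideanSpace ℝ (Fin n) => g ‖x‖) (SphFinsler.symDomain n I))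
    (hh : ContDiffOn ℝ ∞ (fun x : EuclideanSpace ℝ (Fin n) => h ‖x‖) (SphFinsler.symDomain n I))
    (hT : SphFinsler.IsTPair I g T Tbar)
    (hA : ∀ r ∈ I, 0 < T r - r ^ 2 * Tbar r)
    (hpos : ∀ r ∈ I, ∀ s : ℝ, |s| ≤ r → 0 < SphFinsler.phiTwo T Tbar h ε r s) :
    (∀ r ∈ I, ∀ s : ℝ, s ≠ 0 → |s| < r →
      HasDerivAt (fun t => SphFinsler.phiTwo T Tbar h ε r t / t)
        (-(SphFinsler.eta 2 ε (SphFinsler.varphi T Tbar r s) / (s ^ 2 * √(r ^ 2 - s ^ 2)))) s) ∧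
    SphFinsler.IsDouglasMetric (SphFinsler.symDomain n I)
      (SphFinsler.sphMetric n (SphFinsler.phiTwo T Tbar h ε)) ∧
    SphFinsler.IsOfScalarFlagCurvature (SphFinsler.symDomain n I)
      (SphFinsler.sphMetric n (SphFinsler.phiTwo T Tbar h ε)) := by
  have D := SphFinsler.radialData_of_isTPair hn hI hg hh hT hA
  obtain ⟨hF, hR⟩ := SphFinsler.isFinslerMetric_and_isRapcsak hn hI hε hg hh hT hA hpos
  refine ⟨fun r hr s hs hsr => SphFinsler.hasDerivAt_phiTwo_div (hT.pos hr) (hA r hr) hs hsr,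
    ⟨hF, SphFinsler.hasZeroDouglasCurvature_of_isRapcsak hF hR fun x _ => ?_⟩,
    SphFinsler.isOfScalarFlagCurvature_of_isRapcsak hF hR fun p hp u =>
      D.weylDefect_quadFactor hp u⟩
  -- For fixed x, q is the diagonal of g⟨·, ·⟩ + ⟨x, ·⟩⟨f x, ·⟩.
  refine ⟨g ‖x‖ • (show EuclideanSpace ℝ (Fin n) →L[ℝ] EuclideanSpace ℝ (Fin n) →L[ℝ] ℝ
    from innerSL ℝ) + (innerSL ℝ x).smulRight
    (innerSL ℝ (SphFinsler.quadCoeff I g ‖x‖ • x)), fun y _ => ?_⟩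
  rw [SphFinsler.quadFactor, ← real_inner_self_eq_norm_sq]
  rfl
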